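/- Let $d\ge 1$. Call a Lipschitz path $\mathbf{y}:[0,1]\to\mathbb{R}^d$ a \emph{$d$-order path} if $$\det\begin{pmatrix}1&1&\cdots&1\\ \mathbf{y}(t_0)&\mathbf{y}(t_1)&\cdots&\mathbf{y}(t_d)\end{pmatrix}>0\qquad\text{for all }0\le t_0<t_1<\cdots<t_d\le 1,$$ and call a Lipschitz path $\mathbf{x}:[0,1]\to\mathbb{R}^d$ \emph{cyclic} if it is a uniform limit on $[0,1]$ of $d$-order paths. Let $\Delta^d=\{0\le t_1<\cdots<t_d\le 1\}$ and let $\alpha^{(d)}(\mathbf{x})$ denote the top-level alternating signature $$\alpha^{(d)}(\mathbf{x})=\frac{1}{d!}\int_{\Delta^d}\det\big(\mathbf{x}'(t_1),\ldots,\mathbf{x}'(t_d)\big)\,\mathrm{d}t_1\cdots\mathrm{d}t_d ,$$ where $\mathbf{x}'$ is the almost everywhere defined derivative of $\mathbf{x}$; the integrand is integrable on $\Delta^d$. Then, for every cyclic path $\mathbf{x}:[0,1]\to\mathbb{R}^d$, the $d$-dimensional Lebesgue measure of the convex hull of the image of $\mathbf{x}$ is $$\operatorname{vol}(\operatorname{conv}(\mathbf{x}([0,1])))=\alpha^{(d)}(\mathbf{x})=\frac{1}{d!}\int_{\Delta^d}\det\big(\mathbf{x}'(t_1),\ldots,\mathbf{x}'(t_d)\big)\,\mathrm{d}t_1\cdots\mathrm{d}t_d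 .$$ -/

import Mathlib

noncomputable section

/-- `x` restricts to a Lipschitz path `[0,1] → ℝ^d`. Only the values of `x` on `[0,1]` matter. -/
def IsLipschitzPath {d : ℕ} (x : ℝ → EuclideanSpace ℝ (Fin d)) : Prop :=
  ∃ K : NNReal, LipschitzOnWith K x (Set.Icc 0 1)

/-- The `(d+1) × (d+1)` matrix with first row `1, …, 1` and, below it, the columns
`x (t 0), …, x (t d)`. -/
def homogeneousMatrix {d : ℕ} (x : ℝ → EuclideanSpace ℝ (Fin d)) (t : Fin (d + 1) → ℝ) :
    Matrix (Fin (d + 1)) (Fin (d + 1)) ℝ :=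
  Matrix.of fun i j => (Fin.cons 1 (fun a : Fin d => x (t j) a) : Fin (d + 1) → ℝ) i

/-- `d`-order paths: Lipschitz paths in `ℝ^d` all of whose `(d+1)`-tuples of points, taken in
increasing order of the parameter, are affinely independent and positively oriented. -/
def IsOrderPath {d : ℕ} (x : ℝ → EuclideanSpace ℝ (Fin d)) : Prop :=
  IsLipschitzPath x ∧
    ∀ t : Fin (d + 1) → ℝ, StrictMono t → (∀ i, t i ∈ Set.Icc (0 : ℝ) 1) →
      0 < (homogeneousMatrix x t).det

/-- Cyclic paths: Lipschitz paths that are uniform limits on `[0,1]` of `d`-order paths. -/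
def IsCyclicPath {d : ℕ} (x : ℝ → EuclideanSpace ℝ (Fin d)) : Prop :=
  IsLipschitzPath x ∧
    ∃ y : ℕ → ℝ → EuclideanSpace ℝ (Fin d),
      (∀ n, IsOrderPath (y n)) ∧ TendstoUniformlyOn y x Filter.atTop (Set.Icc 0 1)

/-- The simplex `Δ^k = {0 ≤ t_1 < ⋯ < t_k ≤ 1}`. -/
def orderedSimplex (k : ℕ) : Set (Fin k → ℝ) :=
  {t | StrictMono t ∧ ∀ i, t i ∈ Set.Icc (0 : ℝ) 1}

/-- The derivative `x'` of a path on `[0,1]`; for a Lipschitz path it exists almost everywhere. -/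
def pathDeriv {d : ℕ} (x : ℝ → EuclideanSpace ℝ (Fin d)) (t : ℝ) : EuclideanSpace ℝ (Fin d) :=
  derivWithin x (Set.Icc 0 1) t

/-- The component `α_P(x)` of the level `k` alternating signature of `x`, for an order preserving
injection `P : [k] → [d]`: the `1/k!`-multiple of the integral over `Δ^k` of the determinant whose
columns are the `P`-coordinates of `x'(t_1), …, x'(t_k)`. -/
def alternatingSignature {d k : ℕ} (P : Fin k ↪o Fin d) (x : ℝ → EuclideanSpace ℝ (Fin d)) : ℝ :=
  (1 / (k.factorial : ℝ)) *
    ∫ t in orderedSimplex k, (Matrix.of fun a b : Fin k => pathDeriv x (t b) (P a)).det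

/-- The top level alternating signature `α^{(d)}(x)`: the only component at level `k = d` is the
one of the identity `[d] → [d]`. -/
def topAlternatingSignature {d : ℕ} (x : ℝ → EuclideanSpace ℝ (Fin d)) : ℝ :=
  alternatingSignature (RelEmbedding.refl (· ≤ ·) : Fin d ↪o Fin d) x

end

/-! The path is sampled at the mesh points `i / N`, and the theorem is first proved for finitely
many points `p 0, …, p N` in positive order. Their hull is a cyclic polytope. Gale's evenness
condition triangulates it from `p 0`: the other vertices of a cell are `d / 2` pairs `s, s + 1`,
together with `p N` when `d` is odd (`IsOrderSeq.convexHull_eq_biUnion`). That the cells cover the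
hull and overlap in null sets rests on one fact: affine dependencies of such points have at least `d
+ 1` sign changes (`IsOrderSeq.exists_alternating`).

The volume is thus a sum of determinants over sets of pairs. The exterior algebra identity
`list_prod_one_add_increments`, read in degree `d`, turns it into the sum of the determinants of
increments over all increasing `d`-tuples (`sum_det_increments`). This is a discrete form of the
alternating signature.

Two limits remain. For fixed `N`, both sides are continuous in the sample points, so the formula
passes from order paths to cyclic paths (`IsCyclicPath.volume_convexHull_mesh`). As `N → ∞`, the
hulls of the samples converge in volume to the hull of the path
(`IsLipschitzPath.tendsto_volume_mesh`). The determinants of increments are integrals over boxes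
that exhaust the ordered simplex up to a null set (`tendsto_sum_det_increments`). -/

open MeasureTheory

/-! ### Exterior algebra: determinants of increments and determinants of pairs -/

open ExteriorAlgebra in
/-- The linear functional on the exterior algebra of `ℝ^d` that is the determinant in degree `d`
and vanishes in all other degrees. -/
noncomputable def detFunctional (d : ℕ) : ExteriorAlgebra ℝ (Fin d → ℝ) →ₗ[ℝ] ℝ :=
  liftAlternating fun i =>
    if h : d = i then h ▸ (Matrix.detRowAlternating : (Fin d → ℝ) [⋀^Fin d]→ₗ[ℝ] ℝ) else 0

/-- The square matrix whose columns are the vectors `w n`, for `n` running through the list `l`. -/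
def listMatrix {d : ℕ} (w : ℕ → Fin d → ℝ) (l : List ℕ) : Matrix (Fin d) (Fin d) ℝ :=
  Matrix.of fun a b => w (l.getD b 0) a

theorem detFunctional_ιMulti_self {d : ℕ} (v : Fin d → Fin d → ℝ) :
    detFunctional d (ExteriorAlgebra.ιMulti ℝ d v) = Matrix.det v := by
  rw [detFunctional, ExteriorAlgebra.liftAlternating_apply_ιMulti]
  simp only [dite_true]
  rfl

theorem detFunctional_ιMulti_of_ne {d n : ℕ} (h : d ≠ n) (v : Fin n → Fin d → ℝ) :
    detFunctional d (ExteriorAlgebra.ιMulti ℝ n v) = 0 := by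
  rw [detFunctional, ExteriorAlgebra.liftAlternating_apply_ιMulti]
  simp [h]

theorem detFunctional_list_prod {d : ℕ} (w : ℕ → Fin d → ℝ) (l : List ℕ) :
    detFunctional d (l.map fun n => ExteriorAlgebra.ι ℝ (w n)).prod =
      if l.length = d then (listMatrix w l).det else 0 := by
  have key : (l.map fun n => ExteriorAlgebra.ι ℝ (w n)).prod =
      ExteriorAlgebra.ιMulti ℝ l.length (fun i => w (l.getD i 0)) := by
    rw [ExteriorAlgebra.ιMulti_apply]
    congr 1
    apply List.ext_getElem <;> simp
  rw [key]
  split_ifs with h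
  · subst h
    rw [detFunctional_ιMulti_self, ← Matrix.det_transpose]
    rfl
  · exact detFunctional_ιMulti_of_ne (Ne.symm h) _

theorem sort_insert_of_forall_lt {S : Finset ℕ} {n : ℕ} (h : ∀ s ∈ S, s < n) :
    (insert n S).sort (· ≤ ·) = S.sort (· ≤ ·) ++ [n] := by
  have hn : n ∉ S := fun hn => (h n hn).false
  refine List.Perm.eq_of_pairwise (le := (· ≤ ·)) (fun a b _ _ hab hba => le_antisymm hab hba)
    (Finset.pairwise_sort _ _) ?_ ?_
  · refine List.pairwise_append.2 ⟨Finset.pairwise_sort _ _, by simp, ?_⟩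
    intro a ha b hb
    have ha' : a ∈ S := by simpa using ha
    have hb' : b = n := by simpa using hb
    exact hb' ▸ (h a ha').le
  · rw [← Multiset.coe_eq_coe]
    simp [Finset.sort_eq, hn, ← Multiset.coe_add]
    rw [add_comm]; simp

/-- The factors need not commute, so each subset contributes its product in increasing order; hence
the sorted lists. -/
theorem list_prod_one_add {A : Type*} [Ring A] (a : ℕ → A) (N : ℕ) :
    ((List.range N).map fun i => 1 + a i).prod =
      ∑ S ∈ (Finset.range N).powerset, ((S.sort (· ≤ ·)).map a).prod := by
  induction N with
  | zero => simp
  | succ N ih =>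
    rw [List.range_succ, List.map_append, List.prod_append, ih, Finset.range_add_one,
      Finset.sum_powerset_insert (by simp)]
    simp only [List.map_cons, List.map_nil, List.prod_cons, List.prod_nil, mul_one, mul_add]
    congr 1
    rw [Finset.sum_mul]
    refine Finset.sum_congr rfl fun S hS => ?_
    rw [sort_insert_of_forall_lt fun s hs => Finset.mem_range.1 (Finset.mem_powerset.1 hS hs)]
    simp

/-- The noncommutative identity `∏ (1 + v_j) = (∏ (1 + w_i w_{i+1})) (1 + w_N)` for the partial
sums `w_i` of the `v_j`. -/
theorem list_prod_one_add_increments {M : Type*} [AddCommGroup M] [Module ℝ M] (w : ℕ → M)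
    (h0 : w 0 = 0) (N : ℕ) :
    ((List.range N).map fun i => 1 + ExteriorAlgebra.ι ℝ (w (i + 1) - w i)).prod =
      ((List.range N).map fun i =>
        1 + ExteriorAlgebra.ι ℝ (w i) * ExteriorAlgebra.ι ℝ (w (i + 1))).prod *
        (1 + ExteriorAlgebra.ι ℝ (w N)) := by
  induction N with
  | zero => simp [h0]
  | succ N ih =>
    rw [List.range_succ, List.map_append, List.map_append, List.prod_append, List.prod_append, ih]
    simp only [List.map_cons, List.map_nil, List.prod_cons, List.prod_nil, mul_one]
    rw [mul_assoc, mul_assoc]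
    congr 1
    -- Once squares vanish, `(1 + w_N)(1 + w_{N+1} - w_N)` and `(1 + w_N w_{N+1})(1 + w_{N+1})` both
    -- equal `1 + w_{N+1} + w_N w_{N+1}`.
    have h1 : ExteriorAlgebra.ι ℝ (w N) * ExteriorAlgebra.ι ℝ (w N) = 0 :=
      ExteriorAlgebra.ι_sq_zero _
    have h2 : ExteriorAlgebra.ι ℝ (w (N + 1)) * ExteriorAlgebra.ι ℝ (w (N + 1)) = 0 :=
      ExteriorAlgebra.ι_sq_zero _
    rw [map_sub]
    simp only [mul_add, add_mul, mul_sub, one_mul, mul_one, mul_assoc, h1, h2]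
    noncomm_ring

/-- For a set `S` of left end points, the list of the pairs `s, s + 1`, followed by `N` if `d` is
odd. -/
def pairList (d N : ℕ) (S : Finset ℕ) : List ℕ :=
  (S.sort (· ≤ ·)).flatMap (fun s => [s, s + 1]) ++ List.replicate (d % 2) N

theorem length_pairList (d N : ℕ) (S : Finset ℕ) :
    (pairList d N S).length = 2 * S.card + d % 2 := by
  simp [pairList, List.length_flatMap, mul_comm]

theorem mem_pairList {d N : ℕ} {S : Finset ℕ} {n : ℕ} :
    n ∈ pairList d N S ↔ (∃ s ∈ S, n = s ∨ n = s + 1) ∨ (d % 2 ≠ 0 ∧ n = N) := by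
  simp [pairList]

theorem map_pairs_prod {A : Type*} [Ring A] (a : ℕ → A) (l : List ℕ) :
    (l.map fun i => a i * a (i + 1)).prod = ((l.flatMap fun s => [s, s + 1]).map a).prod := by
  induction l with
  | nil => simp
  | cons b l ih => simp [ih, mul_assoc]

/-- Compare the degree `d` parts of the two sides of `list_prod_one_add_increments` through
`detFunctional`. Pairs contribute even degree only, so an odd `d` must use `w N` from the last
factor. -/
theorem sum_det_increments {d : ℕ} (w : ℕ → Fin d → ℝ) (h0 : w 0 = 0) (N : ℕ) :
    ∑ S ∈ (Finset.range N).powersetCard d,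
        (listMatrix (fun i => w (i + 1) - w i) (S.sort (· ≤ ·))).det =
      ∑ S ∈ (Finset.range N).powersetCard (d / 2), (listMatrix w (pairList d N S)).det := by
  have key := congrArg (detFunctional d) (list_prod_one_add_increments w h0 N)
  rw [list_prod_one_add, list_prod_one_add, map_sum, Finset.sum_mul, map_sum] at key
  have hL : ∀ S : Finset ℕ, detFunctional d
      ((S.sort (· ≤ ·)).map fun i => ExteriorAlgebra.ι ℝ (w (i + 1) - w i)).prod =
      if S.card = d then (listMatrix (fun i => w (i + 1) - w i) (S.sort (· ≤ ·))).det else 0 := by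
    intro S
    rw [detFunctional_list_prod (fun i => w (i + 1) - w i)]
    simp
  have hR : ∀ S : Finset ℕ, detFunctional d
      (((S.sort (· ≤ ·)).map fun i => ExteriorAlgebra.ι ℝ (w i) *
        ExteriorAlgebra.ι ℝ (w (i + 1))).prod * (1 + ExteriorAlgebra.ι ℝ (w N))) =
      if S.card = d / 2 then (listMatrix w (pairList d N S)).det else 0 := by
    intro S
    rw [map_pairs_prod (fun i => ExteriorAlgebra.ι ℝ (w i)), mul_add, mul_one, map_add,
      detFunctional_list_prod w]
    have e : ExteriorAlgebra.ι ℝ (w N) = ([N].map fun i => ExteriorAlgebra.ι ℝ (w i)).prod := by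
      simp
    rw [e, ← List.prod_append, ← List.map_append, detFunctional_list_prod w]
    have hlen : ((S.sort (· ≤ ·)).flatMap (fun s => [s, s + 1])).length = 2 * S.card := by
      simp [List.length_flatMap, mul_comm]
    rw [List.length_append, hlen]
    rcases Nat.mod_two_eq_zero_or_one d with hd | hd
    · have c1 : (2 * S.card = d) ↔ S.card = d / 2 := by omega
      have c2 : ¬ (2 * S.card + [N].length = d) := by simp; omega
      rw [if_neg c2, pairList, hd]
      simp [c1]
    · have c1 : ¬ (2 * S.card = d) := by omega
      have c2 : (2 * S.card + [N].length = d) ↔ S.card = d / 2 := by simp; omega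
      simp only [c1, c2, pairList, hd]
      simp
  rw [Finset.sum_congr rfl fun S _ => hL S, Finset.sum_congr rfl fun S _ => hR S,
    ← Finset.sum_filter, ← Finset.sum_filter, ← Finset.powersetCard_eq_filter,
    ← Finset.powersetCard_eq_filter] at key
  exact key

/-! ### Affine dependencies of points in positive order -/

/-- The homogeneous coordinates `(1, v)` of a point `v` of `ℝ^d`. -/
def homogenize {d : ℕ} (v : Fin d → ℝ) : Fin (d + 1) → ℝ := Fin.cons 1 v

/-- The points `p 0, …, p N` of `ℝ^d` are in positive order: every increasing subfamily of `d + 1`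
of them is affinely independent and positively oriented. -/
def IsOrderSeq {d : ℕ} (p : ℕ → Fin d → ℝ) (N : ℕ) : Prop :=
  ∀ i : Fin (d + 1) → ℕ, StrictMono i → (∀ k, i k ≤ N) →
    0 < (Matrix.of fun a b => homogenize (p (i b)) a).det

/-- Any `d + 2` points in positive order satisfy an affine dependency with alternating signs. -/
theorem IsOrderSeq.exists_circuit {d N : ℕ} {p : ℕ → Fin d → ℝ} (hp : IsOrderSeq p N)
    {i : Fin (d + 2) → ℕ} (hi : StrictMono i) (hN : ∀ k, i k ≤ N) :
    ∃ e : ℕ → ℝ, (∀ n, e n ≠ 0 → ∃ k, n = i k) ∧ (∀ k : Fin (d + 2), 0 < (-1) ^ (k : ℕ) * e (i k)) ∧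
      ∑ n ∈ Finset.range (N + 1), e n • homogenize (p n) = 0 := by
  classical
  -- Cramer's rule: up to sign, the coefficients are the maximal minors, all positive by hypothesis.
  let D : Fin (d + 2) → ℝ := fun k =>
    (Matrix.of fun a b => homogenize (p (i (k.succAbove b))) a).det
  have hD : ∀ k, 0 < D k := fun k =>
    hp (fun b => i (k.succAbove b)) (hi.comp k.strictMono_succAbove) fun b => hN _
  have hval : ∀ k : Fin (d + 2), (∑ j : Fin (d + 2), if i j = i k then (-1) ^ (j : ℕ) * D j else 0) =
      (-1) ^ (k : ℕ) * D k := by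
    intro k
    rw [Finset.sum_eq_single k]
    · simp
    · intro b _ hb
      rw [if_neg fun h => hb (hi.injective h)]
    · simp
  refine ⟨fun n => ∑ k : Fin (d + 2), if i k = n then (-1) ^ (k : ℕ) * D k else 0, ?_, ?_, ?_⟩
  · intro n hn
    obtain ⟨k, -, hk⟩ := Finset.exists_ne_zero_of_sum_ne_zero hn
    exact ⟨k, by by_contra h; exact hk (if_neg fun h' => h h'.symm)⟩
  · intro k
    simp only [hval]
    rw [← mul_assoc, ← mul_pow]
    simpa using hD k
  · have h1 : ∑ n ∈ Finset.range (N + 1),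
        (∑ k : Fin (d + 2), if i k = n then (-1) ^ (k : ℕ) * D k else 0) • homogenize (p n) =
        ∑ k : Fin (d + 2), ((-1) ^ (k : ℕ) * D k) • homogenize (p (i k)) := by
      simp only [Finset.sum_smul]
      rw [Finset.sum_comm]
      refine Finset.sum_congr rfl fun k _ => ?_
      rw [Finset.sum_eq_single (i k)]
      · simp
      · intro b _ hb
        rw [if_neg (Ne.symm hb), zero_smul]
      · intro h
        exact absurd (Finset.mem_range.2 (Nat.lt_succ_of_le (hN k))) h
    rw [h1]
    ext a
    -- Row `a` occurs twice in `M`; expanding the zero determinant along the top copy gives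
    -- coordinate `a` of the dependency.
    let M : Matrix (Fin (d + 2)) (Fin (d + 2)) ℝ :=
      Matrix.of (Fin.cons (fun k => homogenize (p (i k)) a) fun a' k => homogenize (p (i k)) a')
    have hM : M.det = 0 := by
      refine Matrix.det_zero_of_row_eq (i := 0) (j := a.succ) (Fin.succ_ne_zero a).symm ?_
      ext k
      simp [M]
    rw [Matrix.det_succ_row_zero] at hM
    rw [Finset.sum_apply, Pi.zero_apply, ← hM]
    refine Finset.sum_congr rfl fun k _ => ?_
    have : M.submatrix Fin.succ k.succAbove =
        Matrix.of fun a b => homogenize (p (i (k.succAbove b))) a := by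
      ext a b
      simp [M]
    rw [this]
    simp only [Pi.smul_apply, smul_eq_mul, M, Matrix.of_apply, Fin.cons_zero, D]
    ring

/-- At most `d + 1` points in positive order are affinely independent. -/
theorem IsOrderSeq.eq_zero_of_card_le {d N : ℕ} {p : ℕ → Fin d → ℝ} (hp : IsOrderSeq p N)
    (hdN : d ≤ N) {c : ℕ → ℝ} (hc : ∀ n, N < n → c n = 0)
    (hsum : ∑ n ∈ Finset.range (N + 1), c n • homogenize (p n) = 0)
    (hcard : ((Finset.range (N + 1)).filter fun n => c n ≠ 0).card ≤ d + 1) : c = 0 := by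
  -- The support is padded to exactly `d + 1` indices, so that a square matrix with positive
  -- determinant applies.
  obtain ⟨U, hU1, hU2, hU3⟩ := Finset.exists_subsuperset_card_eq
    (Finset.filter_subset (fun n => c n ≠ 0) (Finset.range (N + 1))) hcard (by simpa using hdN)
  have hout : ∀ n, n ∉ U → c n = 0 := by
    intro n hn
    by_contra h
    refine hn (hU1 (Finset.mem_filter.2 ⟨Finset.mem_range.2 ?_, h⟩))
    by_contra h'
    exact h (hc n (by omega))
  let f := U.orderEmbOfFin hU3
  have hdet := hp f f.strictMono fun k => by
    have := Finset.mem_range.1 (hU2 (U.orderEmbOfFin_mem hU3 k))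
    show U.orderEmbOfFin hU3 k ≤ N
    omega
  have hz : (fun k => c (f k)) = 0 := by
    refine Matrix.eq_zero_of_mulVec_eq_zero hdet.ne' ?_
    rw [← Finset.sum_subset hU2 fun n _ hn => by rw [hout n hn, zero_smul]] at hsum
    have himg : U = Finset.univ.map f.toEmbedding := (U.map_orderEmbOfFin_univ hU3).symm
    rw [himg, Finset.sum_map] at hsum
    ext a
    have := congrFun hsum a
    simp only [Finset.sum_apply, Pi.smul_apply, smul_eq_mul, Pi.zero_apply] at this
    simp only [Matrix.mulVec, dotProduct, Matrix.of_apply, Pi.zero_apply]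
    rw [← this]
    exact Finset.sum_congr rfl fun k _ => mul_comm _ _
  funext n
  by_cases hn : n ∈ U
  · rw [← Finset.mem_coe, ← U.range_orderEmbOfFin hU3] at hn
    obtain ⟨k, rfl⟩ := hn
    exact congrFun hz k
  · exact hout n hn

/-- A nonzero affine dependency of points in positive order has at least `d + 1` sign changes. -/
theorem IsOrderSeq.exists_alternating {d N : ℕ} {p : ℕ → Fin d → ℝ} (hp : IsOrderSeq p N)
    (hdN : d ≤ N) (c : ℕ → ℝ) (hc : ∀ n, N < n → c n = 0)
    (hsum : ∑ n ∈ Finset.range (N + 1), c n • homogenize (p n) = 0) (hne : c ≠ 0) :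
    ∃ i : Fin (d + 2) → ℕ, StrictMono i ∧ (∀ k, i k ≤ N) ∧
      ∃ ε : ℝ, ∀ k : Fin (d + 2), 0 < ε * ((-1) ^ (k : ℕ) * c (i k)) := by
  induction hcard : ((Finset.range (N + 1)).filter fun n => c n ≠ 0).card using
    Nat.strong_induction_on generalizing c with
  | _ r ih =>
  subst hcard
  by_cases hle : ((Finset.range (N + 1)).filter fun n => c n ≠ 0).card ≤ d + 1
  · exact absurd (hp.eq_zero_of_card_le hdN hc hsum hle) hne
  obtain ⟨U, hU1, hU2⟩ := Finset.exists_subset_card_eq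
    (s := (Finset.range (N + 1)).filter fun n => c n ≠ 0) (n := d + 2) (by omega)
  let i := U.orderEmbOfFin hU2
  have hiU : ∀ k, i k ∈ U := fun k => U.orderEmbOfFin_mem hU2 k
  have hiN : ∀ k, i k ≤ N := fun k => by
    have := Finset.mem_range.1 (Finset.mem_filter.1 (hU1 (hiU k))).1
    omega
  have hci : ∀ k, c (i k) ≠ 0 := fun k => (Finset.mem_filter.1 (hU1 (hiU k))).2
  obtain ⟨e, he1, he2, he3⟩ := hp.exists_circuit i.strictMono hiN
  have hei : ∀ k, e (i k) ≠ 0 := fun k h => by simpa [h] using he2 k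
  have hsgn : ∀ k : Fin (d + 2), ((-1 : ℝ) ^ (k : ℕ)) * (-1) ^ (k : ℕ) = 1 := fun k => by
    rw [← mul_pow]; simp
  by_cases hneg : ∀ k, e (i k) * c (i k) < 0
  · refine ⟨i, i.strictMono, hiN, -1, fun k => ?_⟩
    have h1 := he2 k
    have h2 := hneg k
    have h3 : ((-1) ^ (k : ℕ) * e (i k)) * ((-1) ^ (k : ℕ) * c (i k)) < 0 := by
      calc _ = ((-1 : ℝ) ^ (k : ℕ)) * (-1) ^ (k : ℕ) * (e (i k) * c (i k)) := by ring
        _ < 0 := by rw [hsgn]; simpa using h2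
    have h4 := (pos_iff_neg_of_mul_neg h3).1 h1
    linarith
  by_cases hpos : ∀ k, 0 < e (i k) * c (i k)
  · refine ⟨i, i.strictMono, hiN, 1, fun k => ?_⟩
    have h1 := he2 k
    have h3 : 0 < ((-1) ^ (k : ℕ) * e (i k)) * ((-1) ^ (k : ℕ) * c (i k)) := by
      calc 0 < e (i k) * c (i k) := hpos k
        _ = ((-1 : ℝ) ^ (k : ℕ)) * (-1) ^ (k : ℕ) * (e (i k) * c (i k)) := by rw [hsgn, one_mul]
        _ = _ := by ring
    rw [one_mul]
    exact pos_of_mul_pos_right h3 h1.le |>.trans_le le_rfl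
  push Not at hneg hpos
  obtain ⟨a, ha⟩ := hneg
  obtain ⟨b, hb⟩ := hpos
  have ha' : 0 < e (i a) * c (i a) := lt_of_le_of_ne ha (mul_ne_zero (hei a) (hci a)).symm
  have hb' : e (i b) * c (i b) < 0 := lt_of_le_of_ne hb (mul_ne_zero (hei b) (hci b))
  let V := Finset.univ.filter fun k => 0 < e (i k) * c (i k)
  -- Conformal elimination: subtracting `t • e`, with `t` the least ratio among indices where `c`
  -- and `e` agree in sign, kills the coefficient at `i j` and reverses no sign of `c`. At `i b` the
  -- signs disagree, so the result is not zero, and its alternating signs are also signs of `c`.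
  obtain ⟨j, hjV, hj⟩ := V.exists_min_image (fun k => c (i k) / e (i k))
    ⟨a, Finset.mem_filter.2 ⟨Finset.mem_univ _, ha'⟩⟩
  have hjpos : 0 < e (i j) * c (i j) := (Finset.mem_filter.1 hjV).2
  set t := c (i j) / e (i j) with ht
  have htpos : 0 < t := by
    rw [ht, ← mul_div_mul_left _ _ (hei j)]
    exact div_pos hjpos (mul_self_pos.2 (hei j))
  have hconf : ∀ n, 0 ≤ (c n - t * e n) * c n ∧ (c n = 0 → c n - t * e n = 0) := by
    intro n
    by_cases hn : e n = 0
    · simp [hn, mul_self_nonneg]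
    obtain ⟨k, rfl⟩ := he1 n hn
    refine ⟨?_, fun h => absurd h (hci k)⟩
    rcases lt_or_gt_of_ne (mul_ne_zero (hei k) (hci k)) with h | h
    · nlinarith [mul_self_nonneg (c (i k)), mul_neg_of_pos_of_neg htpos h]
    · have h1 : t ≤ c (i k) / e (i k) := hj k (Finset.mem_filter.2 ⟨Finset.mem_univ _, h⟩)
      have h2 : t * (e (i k) * c (i k)) ≤ c (i k) / e (i k) * (e (i k) * c (i k)) :=
        mul_le_mul_of_nonneg_right h1 h.le
      have h3 : c (i k) / e (i k) * (e (i k) * c (i k)) = c (i k) * c (i k) := by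
        field_simp [hei k]
      nlinarith
  have hlt : ((Finset.range (N + 1)).filter fun n => c n - t * e n ≠ 0).card <
      ((Finset.range (N + 1)).filter fun n => c n ≠ 0).card := by
    refine Finset.card_lt_card (Finset.ssubset_iff_of_subset ?_ |>.2 ⟨i j, hU1 (hiU j), ?_⟩)
    · intro n hn
      rw [Finset.mem_filter] at hn ⊢
      exact ⟨hn.1, fun h => hn.2 ((hconf n).2 h)⟩
    · simp only [Finset.mem_filter, not_and, not_not]
      intro _
      rw [ht, div_mul_cancel₀ _ (hei j), sub_self]
  have hsum' : ∑ n ∈ Finset.range (N + 1), (c n - t * e n) • homogenize (p n) = 0 := by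
    simp only [sub_smul, Finset.sum_sub_distrib, mul_smul, ← Finset.smul_sum, hsum, he3]
    simp
  have hne' : (fun n => c n - t * e n) ≠ 0 := by
    intro h
    have h1 := congrFun h (i b)
    simp only [Pi.zero_apply] at h1
    have h2 : (c (i b) - t * e (i b)) * c (i b) = 0 := by rw [h1, zero_mul]
    nlinarith [mul_self_nonneg (c (i b)), mul_neg_of_pos_of_neg htpos hb']
  obtain ⟨i', hi', hiN', ε, hε⟩ := ih _ hlt (fun n => c n - t * e n)
    (fun n hn => (hconf n).2 (hc n hn)) hsum' hne' rfl
  refine ⟨i', hi', hiN', ε, fun k => ?_⟩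
  have h1 := hε k
  have h2 := (hconf (i' k)).1
  have h3 : c (i' k) - t * e (i' k) ≠ 0 := fun h => by simp [h] at h1
  have h4 : c (i' k) ≠ 0 := fun h => h3 ((hconf (i' k)).2 h)
  have h5 : 0 < (c (i' k) - t * e (i' k)) * c (i' k) :=
    lt_of_le_of_ne h2 (mul_ne_zero h3 h4).symm
  have h6 : 0 < (ε * ((-1) ^ (k : ℕ) * (c (i' k) - t * e (i' k)))) *
      (ε * ((-1) ^ (k : ℕ) * c (i' k))) := by
    have hε0 : ε ≠ 0 := fun h => by simp [h] at h1
    calc 0 < (ε * ε) * ((c (i' k) - t * e (i' k)) * c (i' k)) :=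
          mul_pos (mul_self_pos.2 hε0) h5
      _ = (ε * ε) * (((-1 : ℝ) ^ (k : ℕ)) * (-1) ^ (k : ℕ)) *
          ((c (i' k) - t * e (i' k)) * c (i' k)) := by rw [hsgn, mul_one]
      _ = _ := by ring
  exact pos_of_mul_pos_right h6 h1.le |>.trans_le le_rfl

/-! ### Gale evenness: uniqueness and existence of representations by pairs -/

/-- Pigeonhole: there are `d / 2 + 1` odd positions and only `d / 2` pairs. No odd position holds
`0`, and for odd `d` none holds `N`, since another index follows. Two in the same pair `s, s + 1`
would leave no room for the even position between them. -/
theorem not_odd_support_pairList {d N : ℕ} {S : Finset ℕ} (hS : S.card = d / 2)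
    {i : Fin (d + 2) → ℕ} (hi : StrictMono i) (hN : ∀ k, i k ≤ N)
    (h : ∀ k : Fin (d + 2), (k : ℕ) % 2 = 1 → i k = 0 ∨ i k ∈ pairList d N S) : False := by
  have hlt : ∀ k : Fin (d / 2 + 1), 2 * (k : ℕ) + 1 < d + 2 := fun k => by omega
  have hex : ∀ k : Fin (d / 2 + 1), ∃ s ∈ S,
      i ⟨2 * k + 1, hlt k⟩ = s ∨ i ⟨2 * k + 1, hlt k⟩ = s + 1 := by
    intro k
    have hpos : 0 < i ⟨2 * k + 1, hlt k⟩ :=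
      lt_of_le_of_lt (Nat.zero_le _) (hi (show (0 : Fin (d + 2)) < _ from by
        rw [Fin.lt_def]; simp))
    rcases h ⟨2 * k + 1, hlt k⟩ (by simp) with h0 | h0
    · omega
    rcases mem_pairList.1 h0 with h1 | ⟨h1, h2⟩
    · exact h1
    · have h3 : i ⟨2 * k + 1, hlt k⟩ < i (Fin.last (d + 1)) := hi (by
        rw [Fin.lt_def]; simp; omega)
      have := hN (Fin.last (d + 1))
      omega
  choose f hfS hf using hex
  obtain ⟨a, -, b, -, hab, hfab⟩ := Finset.exists_ne_map_eq_of_card_lt_of_maps_to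
    (s := Finset.univ) (t := S) (f := f) (by simp [hS]) (fun k _ => hfS k)
  wlog hlt' : a < b generalizing a b
  · exact this b a hab.symm hfab.symm (lt_of_le_of_ne (not_lt.1 hlt') hab.symm)
  have h1 : i ⟨2 * a + 1, hlt a⟩ < i ⟨2 * a + 2, by omega⟩ := hi (by rw [Fin.lt_def]; simp)
  have h2 : i ⟨2 * a + 2, by omega⟩ < i ⟨2 * b + 1, hlt b⟩ := hi (by
    rw [Fin.lt_def]; simp; omega)
  have h3 := hf a
  have h4 := hf b
  omega

theorem le_of_mem_pairList {d N : ℕ} {S : Finset ℕ} (hS : S ⊆ Finset.range N) {n : ℕ}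
    (hn : n ∈ pairList d N S) : n ≤ N := by
  rcases mem_pairList.1 hn with ⟨s, hs, h⟩ | ⟨-, h⟩
  · have := Finset.mem_range.1 (hS hs)
    omega
  · exact h.le

/-- A point has at most one representation as a convex combination of `p 0` and of the points
indexed by a list of pairs. -/
theorem IsOrderSeq.pairList_representation_unique {d N : ℕ} {p : ℕ → Fin d → ℝ}
    (hp : IsOrderSeq p N) (hdN : d ≤ N) {S S' : Finset ℕ}
    (hS : S ∈ (Finset.range N).powersetCard (d / 2))
    (hS' : S' ∈ (Finset.range N).powersetCard (d / 2)) {u v : ℕ → ℝ} (hu : ∀ n, 0 ≤ u n)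
    (hv : ∀ n, 0 ≤ v n) (huS : ∀ n, u n ≠ 0 → n = 0 ∨ n ∈ pairList d N S)
    (hvS : ∀ n, v n ≠ 0 → n = 0 ∨ n ∈ pairList d N S')
    (hsum : ∑ n ∈ Finset.range (N + 1), u n • homogenize (p n) =
      ∑ n ∈ Finset.range (N + 1), v n • homogenize (p n)) : u = v := by
  rw [Finset.mem_powersetCard] at hS hS'
  by_contra hne
  obtain ⟨i, hi, hiN, ε, hε⟩ := hp.exists_alternating hdN (fun n => u n - v n)
    (fun n hn => by
      have h1 : u n = 0 := by
        by_contra h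
        rcases huS n h with h | h
        · omega
        · have := le_of_mem_pairList hS.1 h; omega
      have h2 : v n = 0 := by
        by_contra h
        rcases hvS n h with h | h
        · omega
        · have := le_of_mem_pairList hS'.1 h; omega
      simp [h1, h2])
    (by simp only [sub_smul, Finset.sum_sub_distrib, hsum, sub_self])
    (fun h => hne (funext fun n => sub_eq_zero.1 (congrFun h n)))
  -- At all odd positions the same one of `u`, `v` is strictly larger, hence positive, so its
  -- support contradicts `not_odd_support_pairList`.
  have hodd : ∀ k : Fin (d + 2), (k : ℕ) % 2 = 1 → ε * (u (i k) - v (i k)) < 0 := by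
    intro k hk
    have := hε k
    rw [Odd.neg_one_pow (Nat.odd_iff.2 hk)] at this
    linarith
  rcases le_or_gt ε 0 with h | h
  · refine not_odd_support_pairList hS.2 hi hiN fun k hk => huS _ fun h0 => ?_
    have h1 := hodd k hk
    rw [h0] at h1
    nlinarith [hv (i k)]
  · refine not_odd_support_pairList hS'.2 hi hiN fun k hk => hvS _ fun h0 => ?_
    have h1 := hodd k hk
    rw [h0] at h1
    nlinarith [hu (i k)]

/-- A compact set of sequences has a lexicographically largest element, as far as the first `N`
coordinates are concerned. -/
theorem IsCompact.exists_lex_max {K : Set (ℕ → ℝ)} (hK : IsCompact K) (hne : K.Nonempty) (N : ℕ) :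
    ∃ u ∈ K, ∀ v ∈ K, ∀ i < N, (∀ j < i, v j = u j) → v i ≤ u i := by
  induction N with
  | zero => exact ⟨hne.some, hne.some_mem, fun v _ i hi => absurd hi (Nat.not_lt_zero i)⟩
  | succ N ih =>
    obtain ⟨u, huK, hu⟩ := ih
    have hcl : IsClosed {v : ℕ → ℝ | ∀ j < N, v j = u j} := by
      simp only [Set.ofPred_forall]
      exact isClosed_iInter fun j => isClosed_iInter fun _ =>
        isClosed_eq (continuous_apply j) continuous_const
    obtain ⟨u', ⟨hu'K, hu'u⟩, hu'⟩ := (hK.inter_right hcl).exists_isMaxOn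
      ⟨u, huK, fun _ _ => rfl⟩ (continuous_apply N).continuousOn
    refine ⟨u', hu'K, fun v hv i hi hj => ?_⟩
    rcases Nat.lt_succ_iff_lt_or_eq.1 hi with h | rfl
    · rw [hu'u i h]
      exact hu v hv i h fun j hji => (hj j hji).trans (hu'u j (hji.trans h))
    · exact hu' ⟨hv, fun j hji => (hj j hji).trans (hu'u j hji)⟩

/-- A finite set of positive integers without `m + 1` elements at mutual distance at least two is
covered by `m` pairs of consecutive integers. -/
theorem exists_pair_cover (m : ℕ) (X : Finset ℕ) (hX : ∀ x ∈ X, 0 < x)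
    (h : ∀ T ⊆ X, T.card = m + 1 → ∃ a ∈ T, ∃ b ∈ T, a < b ∧ b < a + 2) :
    ∃ S : Finset ℕ, S.card ≤ m ∧ (∀ s ∈ S, s + 1 ∈ X) ∧ ∀ x ∈ X, ∃ s ∈ S, x = s ∨ x = s + 1 := by
  induction m generalizing X with
  | zero =>
    refine ⟨∅, le_rfl, by simp, fun x hx => ?_⟩
    obtain ⟨a, ha, b, hb, hab, -⟩ := h {x} (by simpa using hx) (by simp)
    simp only [Finset.mem_singleton] at ha hb
    omega
  | succ m ih =>
    rcases X.eq_empty_or_nonempty with rfl | hne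
    · exact ⟨∅, by simp, by simp, by simp⟩
    set M := X.max' hne with hM
    have hMX : M ∈ X := X.max'_mem hne
    have hle : ∀ x ∈ X, x ≤ M := fun x hx => X.le_max' x hx
    have hMpos := hX M hMX
    -- Greedy choice: the pair `M - 1, M` covers the top of `X`, and `M` extends any separated
    -- subset of the rest.
    obtain ⟨S, hS1, hS2, hS3⟩ := ih (X.filter fun x => x + 1 < M)
      (fun x hx => hX x (Finset.mem_filter.1 hx).1) (fun T hT hTc => by
        have hT' : ∀ x ∈ T, x ∈ X ∧ x + 1 < M := fun x hx => Finset.mem_filter.1 (hT hx)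
        have hMT : M ∉ T := fun hx => by have := (hT' M hx).2; omega
        obtain ⟨a, ha, b, hb, h1, h2⟩ := h (insert M T)
          (Finset.insert_subset hMX fun x hx => (hT' x hx).1)
          (by rw [Finset.card_insert_of_notMem hMT, hTc])
        rw [Finset.mem_insert] at ha hb
        rcases ha with rfl | ha
        · rcases hb with hb | hb
          · omega
          · have := (hT' b hb).2; omega
        · rcases hb with hb | hb
          · have := (hT' a ha).2; omega
          · exact ⟨a, ha, b, hb, h1, h2⟩)
    refine ⟨insert (M - 1) S, (Finset.card_insert_le _ _).trans (by omega), ?_, ?_⟩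
    · intro s hs
      rcases Finset.mem_insert.1 hs with rfl | hs
      · rwa [Nat.sub_add_cancel hMpos]
      · exact (Finset.mem_filter.1 (hS2 s hs)).1
    · intro x hx
      by_cases hxM : x + 1 < M
      · obtain ⟨s, hs, hxs⟩ := hS3 x (Finset.mem_filter.2 ⟨hx, hxM⟩)
        exact ⟨s, Finset.mem_insert_of_mem hs, hxs⟩
      · exact ⟨M - 1, Finset.mem_insert_self _ _, by have := hle x hx; omega⟩

/-- Interlacing a set of `d / 2 + 1` indices at mutual distance at least two. -/
theorem exists_odd_positions {d N : ℕ} {T : Finset ℕ} (hT : T.card = d / 2 + 1)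
    (hpos : ∀ x ∈ T, 0 < x) (hle : ∀ x ∈ T, x ≤ N) (hodd : d % 2 ≠ 0 → ∀ x ∈ T, x < N)
    (hsep : ∀ a ∈ T, ∀ b ∈ T, a < b → a + 2 ≤ b) :
    ∃ i : Fin (d + 2) → ℕ, StrictMono i ∧ (∀ k, i k ≤ N) ∧
      ∀ k : Fin (d + 2), (k : ℕ) % 2 = 1 → i k ∈ T := by
  -- Positions `2k` and `2k + 1` will hold `τ k - 1` and `τ k`. The default `N + 1` is reached only
  -- for odd `d`, where it puts `N` at the last, even position.
  let τ : ℕ → ℕ := fun k => if h : k < d / 2 + 1 then T.orderEmbOfFin hT ⟨k, h⟩ else N + 1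
  have hτ : ∀ k, k < d / 2 + 1 → τ k ∈ T := fun k hk => by
    simp only [τ, dif_pos hk]
    exact T.orderEmbOfFin_mem hT _
  have hτN : ∀ k, ¬ k < d / 2 + 1 → τ k = N + 1 := fun k hk => by simp only [τ, dif_neg hk]
  have hstep : ∀ k, k + 1 ≤ (d + 1) / 2 → τ k + 2 ≤ τ (k + 1) := by
    intro k hk
    have h1 : k < d / 2 + 1 := by omega
    by_cases h2 : k + 1 < d / 2 + 1
    · refine hsep _ (hτ k h1) _ (hτ (k + 1) h2) ?_
      simp only [τ, dif_pos h1, dif_pos h2]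
      exact (T.orderEmbOfFin hT).strictMono (by rw [Fin.lt_def]; simp)
    · rw [hτN _ h2]
      have := hodd (by omega) _ (hτ k h1)
      omega
  have hτpos : ∀ k, 0 < τ k := fun k => by
    by_cases hk : k < d / 2 + 1
    · exact hpos _ (hτ k hk)
    · rw [hτN k hk]; omega
  refine ⟨fun j => τ (j / 2) - 1 + j % 2, ?_, ?_, ?_⟩
  · rw [Fin.strictMono_iff_lt_succ]
    intro j
    simp only [Fin.val_castSucc, Fin.val_succ]
    rcases Nat.even_or_odd' (j : ℕ) with ⟨k, hk | hk⟩
    · have h1 : (j : ℕ) / 2 = k := by omega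
      have h2 : ((j : ℕ) + 1) / 2 = k := by omega
      rw [h1, h2]
      omega
    · have h1 : (j : ℕ) / 2 = k := by omega
      have h2 : ((j : ℕ) + 1) / 2 = k + 1 := by omega
      rw [h1, h2]
      have := hstep k (by omega)
      have := hτpos k
      omega
  · intro j
    have := hτpos ((j : ℕ) / 2)
    by_cases hk : (j : ℕ) / 2 < d / 2 + 1
    · have := hle _ (hτ _ hk)
      show τ (j / 2) - 1 + j % 2 ≤ N
      omega
    · have h1 := hτN _ hk
      show τ (j / 2) - 1 + j % 2 ≤ N
      omega
  · intro j hj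
    have h1 := hτpos ((j : ℕ) / 2)
    have h2 : τ (j / 2) - 1 + j % 2 = τ (j / 2) := by omega
    show τ (j / 2) - 1 + j % 2 ∈ T
    rw [h2]
    exact hτ _ (by omega)

/-- Every point of the convex hull of points in positive order is a convex combination of `p 0` and
of the points indexed by a list of pairs. -/
theorem IsOrderSeq.exists_pairList_representation {d N : ℕ} {p : ℕ → Fin d → ℝ}
    (hp : IsOrderSeq p N) (hdN : d ≤ N) {q : Fin d → ℝ} {u₀ : ℕ → ℝ} (h0 : ∀ n, 0 ≤ u₀ n)
    (hN : ∀ n, N < n → u₀ n = 0)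
    (hsum : ∑ n ∈ Finset.range (N + 1), u₀ n • homogenize (p n) = homogenize q) :
    ∃ S ∈ (Finset.range N).powersetCard (d / 2), ∃ u : ℕ → ℝ, (∀ n, 0 ≤ u n) ∧
      (∀ n, u n ≠ 0 → n = 0 ∨ n ∈ pairList d N S) ∧
      ∑ n ∈ Finset.range (N + 1), u n • homogenize (p n) = homogenize q := by
  classical
  let K : Set (ℕ → ℝ) := {u | (∀ n, 0 ≤ u n) ∧ (∀ n, N < n → u n = 0) ∧
    ∑ n ∈ Finset.range (N + 1), u n • homogenize (p n) = homogenize q}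
  have hKbd : K ⊆ Set.univ.pi fun _ => Set.Icc 0 1 := by
    rintro u ⟨hu1, hu2, hu3⟩ n -
    refine ⟨hu1 n, ?_⟩
    have hone : ∑ n ∈ Finset.range (N + 1), u n = 1 := by
      simpa [homogenize] using congrFun hu3 0
    rw [← hone]
    by_cases hn : n ∈ Finset.range (N + 1)
    · exact Finset.single_le_sum (fun n _ => hu1 n) hn
    · rw [hu2 n (by simpa using hn)]
      exact Finset.sum_nonneg fun n _ => hu1 n
  have hKcl : IsClosed K := by
    have c1 : IsClosed {u : ℕ → ℝ | ∀ n, 0 ≤ u n} := by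
      simp only [Set.ofPred_forall]
      exact isClosed_iInter fun n => isClosed_le continuous_const (continuous_apply n)
    have c2 : IsClosed {u : ℕ → ℝ | ∀ n, N < n → u n = 0} := by
      simp only [Set.ofPred_forall]
      exact isClosed_iInter fun n => isClosed_iInter fun _ =>
        isClosed_eq (continuous_apply n) continuous_const
    have c3 : IsClosed {u : ℕ → ℝ |
        ∑ n ∈ Finset.range (N + 1), u n • homogenize (p n) = homogenize q} :=
      isClosed_eq (by fun_prop) continuous_const
    exact c1.inter (c2.inter c3)
  have hKc : IsCompact K :=
    (isCompact_univ_pi fun _ => isCompact_Icc).of_isClosed_subset hKcl hKbd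
  obtain ⟨u, ⟨hu1, hu2, hu3⟩, hmax⟩ := hKc.exists_lex_max ⟨u₀, h0, hN, hsum⟩ (N + 1)
  -- Otherwise a small positive multiple of the circuit on `i` can be added to `u`: only the odd
  -- positions decrease, and they have room. The first coordinate to change is `i 0`, which
  -- increases, against lexicographic maximality.
  have hno : ∀ i : Fin (d + 2) → ℕ, StrictMono i → (∀ k, i k ≤ N) →
      ¬ ∀ k : Fin (d + 2), (k : ℕ) % 2 = 1 → 0 < u (i k) := by
    intro i hi hiN hodd
    obtain ⟨e, he1, he2, he3⟩ := hp.exists_circuit hi hiN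
    have hev : ∀ k : Fin (d + 2), ∀ᶠ t : ℝ in nhdsWithin 0 (Set.Ioi 0),
        0 ≤ u (i k) + t * e (i k) := by
      intro k
      rcases Nat.mod_two_eq_zero_or_one (k : ℕ) with hk | hk
      · have := he2 k
        rw [Even.neg_one_pow (Nat.even_iff.2 hk), one_mul] at this
        filter_upwards [self_mem_nhdsWithin] with t ht
        exact add_nonneg (hu1 _) (mul_nonneg (le_of_lt ht) this.le)
      · have hc : Filter.Tendsto (fun t : ℝ => u (i k) + t * e (i k)) (nhdsWithin 0 (Set.Ioi 0))
            (nhds (u (i k) + 0 * e (i k))) :=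
          ((by fun_prop : Continuous fun t : ℝ => u (i k) + t * e (i k)).tendsto 0).mono_left
            nhdsWithin_le_nhds
        filter_upwards [hc.eventually (lt_mem_nhds (a := 0) (by simpa using hodd k hk))] with t ht
        exact ht.le
    obtain ⟨t, ht, htpos⟩ := ((Filter.eventually_all.2 hev).and self_mem_nhdsWithin).exists
    have htpos : 0 < t := htpos
    have hezero : ∀ n, (∀ k, n ≠ i k) → e n = 0 := fun n hn => by
      by_contra h
      obtain ⟨k, hk⟩ := he1 n h
      exact hn k hk
    have hmem : (fun n => u n + t * e n) ∈ K := by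
      refine ⟨fun n => ?_, fun n hn => ?_, ?_⟩
      · by_cases hn : ∃ k, n = i k
        · obtain ⟨k, rfl⟩ := hn
          exact ht k
        · push Not at hn
          simpa [hezero n hn] using hu1 n
      · show u n + t * e n = 0
        rw [hu2 n hn, hezero n fun k hk => by have := hiN k; omega]
        simp
      · simp only [add_smul, Finset.sum_add_distrib, mul_smul, ← Finset.smul_sum, hu3, he3]
        simp
    have h1 := hmax _ hmem (i 0) (Nat.lt_succ_of_le (hiN 0)) fun j hj => by
      show u j + t * e j = u j
      rw [hezero j fun k hk => by
        have := hi.monotone (Fin.zero_le k)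
        omega]
      simp
    have h2 := he2 0
    simp only [Fin.val_zero, pow_zero, one_mul] at h2
    have := mul_pos htpos h2
    linarith
  -- `X` is the part of the support that the pairs must cover; `d / 2 + 1` separated elements of it
  -- would interlace into a family excluded by `hno`.
  let X := (Finset.range (N + 1)).filter fun n => u n ≠ 0 ∧ n ≠ 0 ∧ ¬ (d % 2 ≠ 0 ∧ n = N)
  have hX : ∀ {n}, n ∈ X ↔ n < N + 1 ∧ u n ≠ 0 ∧ n ≠ 0 ∧ ¬ (d % 2 ≠ 0 ∧ n = N) := by
    intro n
    simp only [X, Finset.mem_filter, Finset.mem_range]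
  obtain ⟨S, hS1, hS2, hS3⟩ := exists_pair_cover (d / 2) X
    (fun x hx => Nat.pos_of_ne_zero (hX.1 hx).2.2.1) (fun T hT hTc => by
      by_contra hcon
      push Not at hcon
      obtain ⟨i, hi, hiN, hiT⟩ := exists_odd_positions (N := N) hTc
        (fun x hx => Nat.pos_of_ne_zero (hX.1 (hT hx)).2.2.1)
        (fun x hx => Nat.lt_succ_iff.1 (hX.1 (hT hx)).1)
        (fun hd x hx => by
          have h1 := (hX.1 (hT hx)).1
          have h2 := (hX.1 (hT hx)).2.2.2
          have h3 : x ≠ N := fun h => h2 ⟨hd, h⟩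
          omega)
        hcon
      exact hno i hi hiN fun k hk =>
        lt_of_le_of_ne (hu1 _) (hX.1 (hT (hiT k hk))).2.1.symm)
  have hSN : S ⊆ Finset.range N := fun s hs => by
    have := (hX.1 (hS2 s hs)).1
    exact Finset.mem_range.2 (by omega)
  obtain ⟨S', hSS', hS'N, hS'c⟩ := Finset.exists_subsuperset_card_eq hSN hS1 (by
    rw [Finset.card_range]; omega)
  refine ⟨S', Finset.mem_powersetCard.2 ⟨hS'N, hS'c⟩, u, hu1, fun n hn => ?_, hu3⟩
  by_cases h1 : n = 0
  · exact Or.inl h1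
  refine Or.inr (mem_pairList.2 ?_)
  by_cases h2 : d % 2 ≠ 0 ∧ n = N
  · exact Or.inr h2
  · have hnX : n ∈ X := hX.2 ⟨by
      by_contra h
      exact hn (hu2 n (by omega)), hn, h1, h2⟩
    obtain ⟨s, hs, hns⟩ := hS3 n hnX
    exact Or.inl ⟨s, hSS' hs, hns⟩

/-! ### Volumes of simplices -/

/-- The corner simplex of size `r` in `ℝ^d`. -/
def cornerSimplex (d : ℕ) (r : ℝ) : Set (Fin d → ℝ) := {u | (∀ j, 0 ≤ u j) ∧ ∑ j, u j ≤ r}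

theorem isClosed_cornerSimplex (d : ℕ) (r : ℝ) : IsClosed (cornerSimplex d r) := by
  have c1 : IsClosed {u : Fin d → ℝ | ∀ j, 0 ≤ u j} := by
    simp only [Set.ofPred_forall]
    exact isClosed_iInter fun n => isClosed_le continuous_const (continuous_apply n)
  have c2 : IsClosed {u : Fin d → ℝ | ∑ j, u j ≤ r} := isClosed_le (by fun_prop) continuous_const
  exact c1.inter c2

theorem isCompact_cornerSimplex (d : ℕ) (r : ℝ) : IsCompact (cornerSimplex d r) := by
  refine (isCompact_univ_pi fun _ => isCompact_Icc (a := (0 : ℝ)) (b := r)).of_isClosed_subset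
    (isClosed_cornerSimplex d r) fun u hu j _ => ⟨hu.1 j, ?_⟩
  exact (Finset.single_le_sum (fun j _ => hu.1 j) (Finset.mem_univ j)).trans hu.2

theorem convex_cornerSimplex (d : ℕ) (r : ℝ) : Convex ℝ (cornerSimplex d r) := by
  rintro u ⟨hu1, hu2⟩ v ⟨hv1, hv2⟩ a b ha hb hab
  refine ⟨fun j => add_nonneg (mul_nonneg ha (hu1 j)) (mul_nonneg hb (hv1 j)), ?_⟩
  simp only [Pi.add_apply, Pi.smul_apply, smul_eq_mul, Finset.sum_add_distrib, ← Finset.mul_sum]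
  calc a * ∑ j, u j + b * ∑ j, v j ≤ a * r + b * r := by gcongr
    _ = r := by rw [← add_mul, hab, one_mul]

/-- Slicing at first coordinate `s` leaves a corner simplex of size `r - s`, so the induction must
keep `r` free. -/
theorem volume_cornerSimplex (d : ℕ) (r : ℝ) (hr : 0 ≤ r) :
    volume (cornerSimplex d r) = ENNReal.ofReal (r ^ d / d.factorial) := by
  induction d generalizing r with
  | zero =>
    have : cornerSimplex 0 r = Set.univ := by
      ext u
      simp [cornerSimplex, hr]
    rw [this]
    simp [volume_pi]
  | succ d ih =>
    have hmp := volume_preserving_piFinSuccAbove (fun _ : Fin (d + 1) => ℝ) 0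
    let B : Set (ℝ × (Fin d → ℝ)) := {z | 0 ≤ z.1 ∧ z.2 ∈ cornerSimplex d (r - z.1)}
    have hB : B = {z : ℝ × (Fin d → ℝ) | 0 ≤ z.1} ∩ ({z | ∀ j, 0 ≤ z.2 j} ∩
        {z | z.1 + ∑ j, z.2 j ≤ r}) := by
      ext z
      simp only [B, cornerSimplex, Set.mem_ofPred_eq, Set.mem_inter_iff, le_sub_iff_add_le']
    have hBm : MeasurableSet B := by
      rw [hB]
      refine (measurableSet_le measurable_const measurable_fst).inter (MeasurableSet.inter ?_ ?_)
      · simp only [Set.ofPred_forall]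
        exact MeasurableSet.iInter fun j => measurableSet_le measurable_const (by fun_prop)
      · exact measurableSet_le (by fun_prop) measurable_const
    have hpre : cornerSimplex (d + 1) r =
        (MeasurableEquiv.piFinSuccAbove (fun _ : Fin (d + 1) => ℝ) 0) ⁻¹' B := by
      ext u
      simp only [hB, cornerSimplex, Set.mem_ofPred_eq, Set.mem_inter_iff, Set.mem_preimage,
        MeasurableEquiv.piFinSuccAbove_apply, Fin.forall_fin_succ, Fin.sum_univ_succ]
      simp [Fin.tail, and_assoc]
    rw [hpre, hmp.measure_preimage hBm.nullMeasurableSet, Measure.volume_eq_prod,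
      Measure.prod_apply hBm]
    have hslice : ∀ s : ℝ, volume (Prod.mk s ⁻¹' B) =
        (Set.Icc 0 r).indicator (fun s => ENNReal.ofReal ((r - s) ^ d / d.factorial)) s := by
      intro s
      by_cases hs : s ∈ Set.Icc 0 r
      · rw [Set.indicator_of_mem hs, ← ih (r - s) (by linarith [hs.2])]
        congr 1
        ext y
        simp [B, hs.1]
      · rw [Set.indicator_of_notMem hs]
        have : Prod.mk s ⁻¹' B = ∅ := by
          ext y
          simp only [Set.mem_preimage, Set.mem_empty_iff_false, iff_false]
          rintro ⟨h1, h2, h3⟩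
          have h4 : 0 ≤ ∑ j, y j := Finset.sum_nonneg fun j _ => h2 j
          exact hs ⟨h1, by simp only at h3; linarith⟩
        rw [this, measure_empty]
    simp only [hslice]
    rw [lintegral_indicator measurableSet_Icc, ← ofReal_integral_eq_lintegral_ofReal]
    · congr 1
      rw [integral_Icc_eq_integral_Ioc, ← intervalIntegral.integral_of_le hr,
        intervalIntegral.integral_div, intervalIntegral.integral_comp_sub_left (fun s => s ^ d)]
      simp [Nat.factorial_succ]
      field_simp
    · exact (by fun_prop : Continuous fun s : ℝ => (r - s) ^ d / (d.factorial : ℝ)).continuousOn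
        |>.integrableOn_Icc
    · filter_upwards [ae_restrict_mem measurableSet_Icc] with s hs
      have : 0 ≤ r - s := by linarith [hs.2]
      positivity

/-- The simplex with vertex `a` and with edges the columns of `W` at this vertex. -/
def edgeSimplex {d : ℕ} (a : Fin d → ℝ) (W : Matrix (Fin d) (Fin d) ℝ) : Set (Fin d → ℝ) :=
  (fun u => a + W.mulVec u) '' cornerSimplex d 1

theorem volume_image_affine {d : ℕ} (a : Fin d → ℝ) (W : Matrix (Fin d) (Fin d) ℝ)
    (s : Set (Fin d → ℝ)) :
    volume ((fun u => a + W.mulVec u) '' s) = ENNReal.ofReal |W.det| * volume s := by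
  have h1 : (fun u => a + W.mulVec u) '' s = (fun x => a + x) '' (Matrix.toLin' W '' s) := by
    rw [Set.image_image]
    rfl
  rw [h1, Set.image_add_left, measure_preimage_add, Measure.addHaar_image_linearMap,
    LinearMap.det_toLin']

theorem volume_edgeSimplex {d : ℕ} (a : Fin d → ℝ) (W : Matrix (Fin d) (Fin d) ℝ) :
    volume (edgeSimplex a W) = ENNReal.ofReal (|W.det| / d.factorial) := by
  rw [edgeSimplex, volume_image_affine, volume_cornerSimplex d 1 zero_le_one,
    ← ENNReal.ofReal_mul (abs_nonneg _)]
  simp [div_eq_mul_inv]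

theorem isCompact_edgeSimplex {d : ℕ} (a : Fin d → ℝ) (W : Matrix (Fin d) (Fin d) ℝ) :
    IsCompact (edgeSimplex a W) :=
  (isCompact_cornerSimplex d 1).image
    (continuous_const.add (Matrix.toLin' W).continuous_of_finiteDimensional)

theorem convex_edgeSimplex {d : ℕ} (a : Fin d → ℝ) (W : Matrix (Fin d) (Fin d) ℝ) :
    Convex ℝ (edgeSimplex a W) := by
  have h1 : edgeSimplex a W = (fun x => a + x) '' (Matrix.toLin' W '' cornerSimplex d 1) := by
    rw [Set.image_image]
    rfl
  rw [h1]
  exact ((convex_cornerSimplex d 1).linear_image _).translate a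

theorem vertex_mem_edgeSimplex {d : ℕ} (a : Fin d → ℝ) (W : Matrix (Fin d) (Fin d) ℝ) :
    a ∈ edgeSimplex a W :=
  ⟨0, ⟨fun _ => le_rfl, by simp⟩, by simp⟩

theorem add_col_mem_edgeSimplex {d : ℕ} (a : Fin d → ℝ) (W : Matrix (Fin d) (Fin d) ℝ)
    (j : Fin d) : a + W.col j ∈ edgeSimplex a W :=
  ⟨Pi.single j 1, ⟨fun k => by
    by_cases h : k = j
    · subst h; simp
    · simp [h], by simp⟩, by simp⟩

/-! ### Triangulation of the hull of points in positive order -/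

theorem sum_smul_homogenize_iff {d : ℕ} {ι : Type*} {s : Finset ι} {u : ι → ℝ}
    {p : ι → Fin d → ℝ} {q : Fin d → ℝ} :
    ∑ n ∈ s, u n • homogenize (p n) = homogenize q ↔
      ∑ n ∈ s, u n = 1 ∧ ∑ n ∈ s, u n • p n = q := by
  constructor
  · intro h
    refine ⟨by simpa [homogenize] using congrFun h 0, ?_⟩
    ext a
    simpa [homogenize] using congrFun h a.succ
  · rintro ⟨h1, h2⟩
    ext a
    refine Fin.cases ?_ (fun a => ?_) a
    · simpa [homogenize] using h1
    · simpa [homogenize] using congrFun h2 a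

/-- The determinant of homogeneous coordinates in terms of the edges at the first vertex. -/
theorem det_homogenize_cons {d : ℕ} (p : ℕ → Fin d → ℝ) (idx : Fin d → ℕ) :
    (Matrix.of fun a b => homogenize (p ((Fin.cons 0 idx : Fin (d + 1) → ℕ) b)) a).det =
      (Matrix.of fun a b => (p (idx b) - p 0) a).det := by
  let B : Matrix (Fin (d + 1)) (Fin (d + 1)) ℝ :=
    Matrix.of fun b a => (Fin.cons (homogenize (p 0) a)
      (fun j => homogenize (p (idx j)) a - homogenize (p 0) a) : Fin (d + 1) → ℝ) b
  have h1 : (Matrix.of fun a b => homogenize (p ((Fin.cons 0 idx : Fin (d + 1) → ℕ) b)) a).det =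
      B.det := by
    rw [← Matrix.det_transpose]
    refine Matrix.det_eq_of_forall_row_eq_smul_add_const
      (Fin.cons 0 (fun _ => 1) : Fin (d + 1) → ℝ) 0 rfl ?_
    intro b a
    refine Fin.cases ?_ (fun b => ?_) b <;> simp [B]
  rw [h1, ← Matrix.det_transpose, Matrix.det_succ_row_zero, Finset.sum_eq_single 0]
  · have : (B.transpose.submatrix Fin.succ (Fin.succAbove 0)) =
        Matrix.of fun a b => (p (idx b) - p 0) a := by
      ext a b
      simp [B, homogenize]
    rw [this]
    simp [B, homogenize]
  · intro b _ hb
    obtain ⟨j, rfl⟩ := Fin.exists_succ_eq.2 hb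
    simp [B, homogenize]
  · simp

theorem pairwise_le_pairList {d N : ℕ} {S : Finset ℕ} (hS : S ⊆ Finset.range N) :
    (pairList d N S).Pairwise (· ≤ ·) := by
  rw [pairList, List.pairwise_append]
  refine ⟨?_, by simp [List.pairwise_replicate], ?_⟩
  · rw [List.pairwise_flatMap]
    refine ⟨by simp, ?_⟩
    refine (S.sortedLT_sort).pairwise.imp ?_
    intro a b hab x hx y hy
    simp only [List.mem_cons, List.not_mem_nil, or_false] at hx hy
    omega
  · intro a ha b hb
    have hb' : b = N := (List.mem_replicate.1 hb).2
    rw [hb']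
    exact le_of_mem_pairList (d := d) hS (by rw [pairList]; exact List.mem_append_left _ ha)

theorem length_pairList_of_card {d N : ℕ} {S : Finset ℕ} (hS : S.card = d / 2) :
    (pairList d N S).length = d := by
  rw [length_pairList, hS]
  omega

theorem exists_getD_eq_of_mem {d : ℕ} {l : List ℕ} (hl : l.length = d) {n : ℕ} (hn : n ∈ l) :
    ∃ j : Fin d, l.getD j 0 = n := by
  obtain ⟨k, hk, rfl⟩ := List.mem_iff_getElem.1 hn
  exact ⟨⟨k, hl ▸ hk⟩, by simp [hk]⟩

theorem getD_mem_of_length {d : ℕ} {l : List ℕ} (hl : l.length = d) (j : Fin d) :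
    l.getD j 0 ∈ l := by
  have hj : (j : ℕ) < l.length := hl ▸ j.2
  rw [List.getD_eq_getElem _ _ hj]
  exact List.getElem_mem hj

/-- The list is weakly increasing. If it is strict and avoids `0`, prefixing `0` gives a positive
determinant of the sequence; otherwise a column is zero or repeated. -/
theorem IsOrderSeq.det_pairList_nonneg {d N : ℕ} {p : ℕ → Fin d → ℝ} (hp : IsOrderSeq p N)
    {S : Finset ℕ} (hS : S ∈ (Finset.range N).powersetCard (d / 2)) :
    0 ≤ (listMatrix (fun n => p n - p 0) (pairList d N S)).det := by
  rw [Finset.mem_powersetCard] at hS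
  have hl := length_pairList_of_card (N := N) hS.2
  set l := pairList d N S with hldef
  by_cases h0 : ∃ j : Fin d, l.getD j 0 = 0
  · obtain ⟨j, hj⟩ := h0
    refine (Matrix.det_eq_zero_of_column_eq_zero j fun a => ?_).ge
    simp only [listMatrix, Matrix.of_apply, hj, sub_self, Pi.zero_apply]
  by_cases hinj : Function.Injective fun j : Fin d => l.getD j 0
  · have hmono : StrictMono fun j : Fin d => l.getD j 0 := by
      refine Monotone.strictMono_of_injective ?_ hinj
      intro a b hab
      rcases hab.eq_or_lt with rfl | hab
      · exact le_rfl
      have ha : (a : ℕ) < l.length := by have := a.2; omega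
      have hb : (b : ℕ) < l.length := by have := b.2; omega
      simp only [List.getD_eq_getElem _ _ ha, List.getD_eq_getElem _ _ hb]
      exact List.pairwise_iff_getElem.1 (pairwise_le_pairList hS.1) _ _ ha hb hab
    have := hp (Fin.cons 0 fun j : Fin d => l.getD j 0)
      (by
        refine Fin.strictMono_iff_lt_succ.2 fun j => ?_
        rw [Fin.cons_succ]
        by_cases hj : (j : ℕ) = 0
        · have : j.castSucc = 0 := Fin.ext hj
          rw [this, Fin.cons_zero]
          exact Nat.pos_of_ne_zero fun h => h0 ⟨j, h⟩
        · have : j.castSucc = (⟨j - 1, by omega⟩ : Fin d).succ := by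
            ext; simp; omega
          rw [this, Fin.cons_succ]
          exact hmono (by rw [Fin.lt_def]; simp; omega))
      (fun k => by
        refine Fin.cases ?_ (fun j => ?_) k
        · simp
        · rw [Fin.cons_succ]
          exact le_of_mem_pairList hS.1 (getD_mem_of_length hl j))
    rw [det_homogenize_cons] at this
    exact this.le
  · simp only [Function.Injective, not_forall] at hinj
    obtain ⟨a, b, hab, hne⟩ := hinj
    refine (Matrix.det_zero_of_column_eq hne fun k => ?_).ge
    simp only [listMatrix, Matrix.of_apply, hab]

/-- The coefficients of a point of a simplex, indexed by the whole sequence of points. -/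
theorem exists_coeff_of_mem_cornerSimplex {d N : ℕ} (p : ℕ → Fin d → ℝ) {l : List ℕ}
    (hl : l.length = d) (hlN : ∀ n ∈ l, n ≤ N) {x : Fin d → ℝ} (hx : x ∈ cornerSimplex d 1) :
    ∃ u : ℕ → ℝ, (∀ n, 0 ≤ u n) ∧ (∀ n, u n ≠ 0 → n = 0 ∨ n ∈ l) ∧
      (∀ j : Fin d, x j ≤ u (l.getD j 0)) ∧
      ∑ n ∈ Finset.range (N + 1), u n • homogenize (p n) =
        homogenize (p 0 + (listMatrix (fun n => p n - p 0) l).mulVec x) := by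
  have hnn : ∀ n (j : Fin d), 0 ≤ if l.getD j 0 = n then x j else 0 := fun n j => by
    split_ifs
    exacts [hx.1 j, le_rfl]
  have hz : ∀ n, 0 ≤ if n = 0 then 1 - ∑ j, x j else 0 := fun n => by
    split_ifs
    exacts [sub_nonneg.2 hx.2, le_rfl]
  -- Indices may repeat in `l` or equal `0`, so weights accumulate and only `x j ≤ u (l.getD j 0)`
  -- holds.
  refine ⟨fun n => (if n = 0 then 1 - ∑ j, x j else 0) + ∑ j : Fin d,
    if l.getD j 0 = n then x j else 0, ?_, ?_, ?_, ?_⟩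
  · exact fun n => add_nonneg (hz n) (Finset.sum_nonneg fun j _ => hnn n j)
  · intro n hn
    by_contra hcon
    push Not at hcon
    refine hn ?_
    simp only [hcon.1, if_false, zero_add]
    refine Finset.sum_eq_zero fun j _ => if_neg fun h => hcon.2 ?_
    rw [← h]
    exact getD_mem_of_length hl j
  · intro j
    refine le_add_of_nonneg_of_le (hz _) ?_
    have := Finset.single_le_sum (fun k _ => hnn (l.getD j 0) k) (Finset.mem_univ j)
    simpa using this
  · have hkey : ∀ {E : Type} [AddCommGroup E] [Module ℝ E] (f : ℕ → E),
        ∑ n ∈ Finset.range (N + 1), ((if n = 0 then 1 - ∑ j, x j else 0) + ∑ j : Fin d,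
          if l.getD j 0 = n then x j else 0) • f n =
        (1 - ∑ j, x j) • f 0 + ∑ j : Fin d, x j • f (l.getD j 0) := by
      intro E _ _ f
      simp only [add_smul, Finset.sum_add_distrib, Finset.sum_smul]
      congr 1
      · rw [Finset.sum_eq_single 0]
        · simp
        · intro b _ hb
          simp [hb]
        · simp
      · rw [Finset.sum_comm]
        refine Finset.sum_congr rfl fun j _ => ?_
        rw [Finset.sum_eq_single (l.getD j 0)]
        · simp
        · intro b _ hb
          rw [if_neg (Ne.symm hb), zero_smul]
        · intro h
          exact absurd (Finset.mem_range.2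
            (Nat.lt_succ_of_le (hlN _ (getD_mem_of_length hl j)))) h
    rw [sum_smul_homogenize_iff]
    constructor
    · have := hkey (fun _ => (1 : ℝ))
      simpa using this
    · rw [hkey]
      ext a
      simp only [Pi.add_apply, Pi.smul_apply, smul_eq_mul, Finset.sum_apply, Matrix.mulVec,
        dotProduct, listMatrix, Matrix.of_apply, Pi.sub_apply, sub_mul, Finset.sum_sub_distrib,
        ← Finset.mul_sum]
      rw [Finset.sum_congr rfl fun (j : Fin d) _ => mul_comm (x j) (p (l.getD j 0) a)]
      ring

/-- Both pairs contain `r + 1`, which gives two equal columns. -/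
theorem det_pairList_eq_zero_of_consecutive {d N : ℕ} {w : ℕ → Fin d → ℝ} {S : Finset ℕ}
    (hS : S.card = d / 2) {r : ℕ} (hr : r ∈ S) (hr' : r + 1 ∈ S) :
    (listMatrix w (pairList d N S)).det = 0 := by
  have hl := length_pairList_of_card (N := N) hS
  have hnd : ¬ (pairList d N S).Nodup := by
    intro h
    rw [pairList, List.nodup_append] at h
    have h1 := (List.nodup_flatMap.1 h.1).2
    have : Std.Symm (Function.onFun List.Disjoint fun s => [s, s + 1]) :=
      ⟨fun a b hab => List.Disjoint.symm hab⟩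
    have h2 : List.Disjoint [r, r + 1] [r + 1, r + 1 + 1] :=
      h1.forall ((Finset.mem_sort _).2 hr) ((Finset.mem_sort _).2 hr') (by omega)
    exact h2 (a := r + 1) (by simp) (by simp)
  rw [List.nodup_iff_injective_get, Function.Injective] at hnd
  push Not at hnd
  obtain ⟨a, b, hab, hne⟩ := hnd
  refine Matrix.det_zero_of_column_eq (i := Fin.cast hl a) (j := Fin.cast hl b)
    (fun h => hne (Fin.cast_injective hl h)) fun k => ?_
  simp only [List.get_eq_getElem] at hab
  simp [listMatrix, hab]

/-- If the cell of `S` is not degenerate, `s` is neither `0` nor in the list of `S'`: were `s = r +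
1` with `r ∈ S'`, minimality would put `r` in `S` next to `s`. By uniqueness of representations, a
common point has weight `0` at `s`, so it lies on one facet hyperplane. -/
theorem IsOrderSeq.volume_inter_eq_zero {d N : ℕ} {p : ℕ → Fin d → ℝ}
    (hp : IsOrderSeq p N) (hdN : d ≤ N) {S S' : Finset ℕ}
    (hS : S ∈ (Finset.range N).powersetCard (d / 2))
    (hS' : S' ∈ (Finset.range N).powersetCard (d / 2)) {s : ℕ} (hs : s ∈ S) (hs' : s ∉ S')
    (hmin : ∀ r < s, r ∈ S' → r ∈ S) :
    volume (edgeSimplex (p 0) (listMatrix (fun n => p n - p 0) (pairList d N S)) ∩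
      edgeSimplex (p 0) (listMatrix (fun n => p n - p 0) (pairList d N S'))) = 0 := by
  have hS0 := Finset.mem_powersetCard.1 hS
  have hS0' := Finset.mem_powersetCard.1 hS'
  have hl := length_pairList_of_card (N := N) hS0.2
  have hl' := length_pairList_of_card (N := N) hS0'.2
  by_cases hdet : (listMatrix (fun n => p n - p 0) (pairList d N S)).det = 0
  · refine measure_mono_null Set.inter_subset_left ?_
    rw [volume_edgeSimplex, hdet]
    simp
  obtain ⟨j, hj⟩ := exists_getD_eq_of_mem hl
    (mem_pairList.2 (Or.inl ⟨s, hs, Or.inl rfl⟩) : s ∈ pairList d N S)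
  have hs0 : s ≠ 0 := by
    intro h
    refine hdet (Matrix.det_eq_zero_of_column_eq_zero j fun a => ?_)
    simp only [listMatrix, Matrix.of_apply, hj, h, sub_self, Pi.zero_apply]
  have hsl : s ∉ pairList d N S' := by
    intro h
    rcases mem_pairList.1 h with ⟨r, hr, rfl | rfl⟩ | ⟨-, h⟩
    · exact hs' hr
    · exact hdet (det_pairList_eq_zero_of_consecutive hS0.2 (hmin r (by omega) hr) hs)
    · have := Finset.mem_range.1 (hS0.1 hs)
      omega
  have hnull : volume ((fun u => p 0 + (listMatrix (fun n => p n - p 0)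
      (pairList d N S)).mulVec u) '' {u | u j = 0}) = 0 := by
    rw [volume_image_affine, volume_pi, Measure.pi_hyperplane, mul_zero]
  refine measure_mono_null ?_ hnull
  rintro q ⟨⟨x, hx, hxq⟩, ⟨y, hy, hyq⟩⟩
  refine ⟨x, ?_, hxq⟩
  obtain ⟨u, hu1, hu2, hu3, hu4⟩ := exists_coeff_of_mem_cornerSimplex (N := N) p hl
    (fun n hn => le_of_mem_pairList hS0.1 hn) hx
  obtain ⟨v, hv1, hv2, -, hv4⟩ := exists_coeff_of_mem_cornerSimplex (N := N) p hl'
    (fun n hn => le_of_mem_pairList hS0'.1 hn) hy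
  have huv := hp.pairList_representation_unique hdN hS hS' hu1 hv1 hu2 hv2 (by
    rw [hu4, hv4]
    exact congrArg homogenize (hxq.trans hyq.symm))
  have hvs : v s = 0 := by
    by_contra h
    rcases hv2 s h with h | h
    · exact hs0 h
    · exact hsl h
  have h1 := hu3 j
  rw [hj, huv, hvs] at h1
  exact le_antisymm h1 (hx.1 j)

theorem IsOrderSeq.aedisjoint_edgeSimplex {d N : ℕ} {p : ℕ → Fin d → ℝ}
    (hp : IsOrderSeq p N) (hdN : d ≤ N) {S S' : Finset ℕ}
    (hS : S ∈ (Finset.range N).powersetCard (d / 2))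
    (hS' : S' ∈ (Finset.range N).powersetCard (d / 2)) (hne : S ≠ S') :
    AEDisjoint volume (edgeSimplex (p 0) (listMatrix (fun n => p n - p 0) (pairList d N S)))
      (edgeSimplex (p 0) (listMatrix (fun n => p n - p 0) (pairList d N S'))) := by
  have hex : ∃ s, ¬ (s ∈ S ↔ s ∈ S') := by
    by_contra h
    push Not at h
    exact hne (Finset.ext h)
  classical
  have hspec := Nat.find_spec hex
  have hmin : ∀ r < Nat.find hex, (r ∈ S ↔ r ∈ S') := fun r hr => not_not.1 (Nat.find_min hex hr)
  by_cases hs : Nat.find hex ∈ S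
  · exact hp.volume_inter_eq_zero hdN hS hS' hs (fun h => hspec (iff_of_true hs h))
      fun r hr h => (hmin r hr).2 h
  · have hs' : Nat.find hex ∈ S' := by
      by_contra h
      exact hspec (iff_of_false hs h)
    rw [AEDisjoint, Set.inter_comm]
    exact hp.volume_inter_eq_zero hdN hS' hS hs' hs fun r hr h => (hmin r hr).1 h

theorem exists_coeff_of_mem_convexHull {d N : ℕ} (p : ℕ → Fin d → ℝ) {q : Fin d → ℝ}
    (hq : q ∈ convexHull ℝ (p '' Set.Iic N)) :
    ∃ u : ℕ → ℝ, (∀ n, 0 ≤ u n) ∧ (∀ n, N < n → u n = 0) ∧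
      ∑ n ∈ Finset.range (N + 1), u n • homogenize (p n) = homogenize q := by
  let C : Set (Fin d → ℝ) := {q | ∃ u : ℕ → ℝ, (∀ n, 0 ≤ u n) ∧ (∀ n, N < n → u n = 0) ∧
      ∑ n ∈ Finset.range (N + 1), u n = 1 ∧ ∑ n ∈ Finset.range (N + 1), u n • p n = q}
  have hC : Convex ℝ C := by
    rintro x ⟨u, hu1, hu2, hu3, hu4⟩ y ⟨v, hv1, hv2, hv3, hv4⟩ a b ha hb hab
    refine ⟨fun n => a * u n + b * v n,
      fun n => add_nonneg (mul_nonneg ha (hu1 n)) (mul_nonneg hb (hv1 n)),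
      fun n hn => by simp [hu2 n hn, hv2 n hn], ?_, ?_⟩
    · rw [Finset.sum_add_distrib, ← Finset.mul_sum, ← Finset.mul_sum, hu3, hv3, mul_one, mul_one,
        hab]
    · simp only [add_smul, mul_smul, Finset.sum_add_distrib, ← Finset.smul_sum, hu4, hv4]
  have hsub : p '' Set.Iic N ⊆ C := by
    rintro _ ⟨n, hn, rfl⟩
    have hn' : n < N + 1 := Nat.lt_succ_of_le hn
    refine ⟨Pi.single n 1, fun k => ?_, fun k hk => ?_, ?_, ?_⟩
    · by_cases h : k = n
      · subst h; simp
      · simp [h]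
    · rw [Pi.single_eq_of_ne]
      rintro rfl
      omega
    · simp [Finset.sum_pi_single', hn']
    · rw [Finset.sum_eq_single n]
      · simp
      · intro b _ hb
        simp [hb]
      · intro h
        exact absurd (Finset.mem_range.2 hn') h
  obtain ⟨u, h1, h2, h3, h4⟩ := convexHull_min hsub hC hq
  exact ⟨u, h1, h2, sum_smul_homogenize_iff.2 ⟨h3, h4⟩⟩

/-- The triangulation of the convex hull of points in positive order. -/
theorem IsOrderSeq.convexHull_eq_biUnion {d N : ℕ} {p : ℕ → Fin d → ℝ}
    (hp : IsOrderSeq p N) (hdN : d ≤ N) :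
    convexHull ℝ (p '' Set.Iic N) = ⋃ S ∈ (Finset.range N).powersetCard (d / 2),
      edgeSimplex (p 0) (listMatrix (fun n => p n - p 0) (pairList d N S)) := by
  apply Set.Subset.antisymm
  · intro q hq
    obtain ⟨u₀, h1, h2, h3⟩ := exists_coeff_of_mem_convexHull p hq
    obtain ⟨S, hS, u, hu1, hu2, hu3⟩ := hp.exists_pairList_representation hdN h1 h2 h3
    refine Set.mem_biUnion hS ?_
    have hl := length_pairList_of_card (N := N) (Finset.mem_powersetCard.1 hS).2
    obtain ⟨hu4, hu5⟩ := sum_smul_homogenize_iff.1 hu3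
    rw [← Finset.sum_filter_of_ne (p := fun n => u n ≠ 0) fun n _ h => h] at hu4
    rw [← Finset.sum_filter_of_ne (p := fun n => u n ≠ 0) fun n _ h h0 => h (by
      rw [h0, zero_smul])] at hu5
    rw [← hu5]
    refine (convex_edgeSimplex _ _).sum_mem (fun n _ => hu1 n) hu4 fun n hn => ?_
    rcases hu2 n (Finset.mem_filter.1 hn).2 with rfl | h
    · exact vertex_mem_edgeSimplex _ _
    · obtain ⟨j, hj⟩ := exists_getD_eq_of_mem hl h
      have := add_col_mem_edgeSimplex (p 0)
        (listMatrix (fun n => p n - p 0) (pairList d N S)) j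
      convert this using 1
      ext a
      simp only [Pi.add_apply, Matrix.col_apply, listMatrix, Matrix.of_apply, hj, Pi.sub_apply]
      ring
  · refine Set.iUnion₂_subset fun S hS => ?_
    rintro _ ⟨x, hx, rfl⟩
    have hS0 := Finset.mem_powersetCard.1 hS
    obtain ⟨u, hu1, hu2, -, hu4⟩ := exists_coeff_of_mem_cornerSimplex (N := N) p
      (length_pairList_of_card (N := N) hS0.2) (fun n hn => le_of_mem_pairList hS0.1 hn) hx
    obtain ⟨hu5, hu6⟩ := sum_smul_homogenize_iff.1 hu4
    show p 0 + _ ∈ _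
    rw [← hu6]
    exact (convex_convexHull ℝ _).sum_mem (fun n _ => hu1 n) hu5 fun n hn =>
      subset_convexHull ℝ _ ⟨n, Nat.lt_succ_iff.1 (Finset.mem_range.1 hn), rfl⟩

/-- The cell volumes add up to the pair side of `sum_det_increments` for `w n = p n - p 0`;
nonnegativity removes the absolute values. -/
theorem IsOrderSeq.volume_convexHull {d N : ℕ} {p : ℕ → Fin d → ℝ}
    (hp : IsOrderSeq p N) (hdN : d ≤ N) :
    volume.real (convexHull ℝ (p '' Set.Iic N)) = (1 / (d.factorial : ℝ)) *
      ∑ S ∈ (Finset.range N).powersetCard d,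
        (listMatrix (fun n => p (n + 1) - p n) (S.sort (· ≤ ·))).det := by
  have hsum := sum_det_increments (fun n => p n - p 0) (sub_self _) N
  simp only [sub_sub_sub_cancel_right] at hsum
  rw [hsum, hp.convexHull_eq_biUnion hdN, measureReal_def, measure_biUnion_finset₀
    (fun S hS S' hS' hne => hp.aedisjoint_edgeSimplex hdN hS hS' hne)
    (fun S _ => (isCompact_edgeSimplex _ _).measurableSet.nullMeasurableSet),
    ENNReal.toReal_sum fun S _ => (isCompact_edgeSimplex _ _).measure_ne_top, Finset.mul_sum]
  refine Finset.sum_congr rfl fun S hS => ?_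
  rw [volume_edgeSimplex, abs_of_nonneg (hp.det_pairList_nonneg hS), ENNReal.toReal_ofReal]
  · ring
  · exact div_nonneg (hp.det_pairList_nonneg hS) (Nat.cast_nonneg _)

/-! ### Convergence of volumes of convex sets -/

/-- The frontier of a convex set is null, and off it the indicators of `B n` converge pointwise to
that of `A`. -/
theorem tendsto_volume_of_subset_thickening {E : Type*} [NormedAddCommGroup E]
    [InnerProductSpace ℝ E] [FiniteDimensional ℝ E] [MeasurableSpace E] [BorelSpace E]
    {A : Set E} {B : ℕ → Set E} (hA : IsCompact A) (hAc : Convex ℝ A)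
    (hB : ∀ n, IsClosed (B n)) (hBc : ∀ n, Convex ℝ (B n))
    (h1 : ∀ ε > 0, ∀ᶠ n in Filter.atTop, A ⊆ Metric.thickening ε (B n))
    (h2 : ∀ ε > 0, ∀ᶠ n in Filter.atTop, B n ⊆ Metric.thickening ε A) :
    Filter.Tendsto (fun n => volume.real (B n)) Filter.atTop (nhds (volume.real A)) := by
  refine (ENNReal.tendsto_toReal hA.measure_ne_top).comp ?_
  refine tendsto_measure_of_ae_tendsto_indicator (B := Metric.cthickening 1 A) Filter.atTop
    hA.measurableSet (fun n => (hB n).measurableSet) Metric.isClosed_cthickening.measurableSet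
    hA.cthickening.measure_ne_top ?_ ?_
  · filter_upwards [h2 1 one_pos] with n hn
    exact hn.trans (Metric.thickening_subset_cthickening _ _)
  · have hfr : ∀ᵐ q ∂(volume : Measure E), q ∉ frontier A :=
      measure_eq_zero_iff_ae_notMem.1 (hAc.addHaar_frontier volume)
    filter_upwards [hfr] with q hq
    by_cases hqA : q ∈ A
    · have hqi : q ∈ interior A := by
        by_contra h
        exact hq (by rw [hA.isClosed.frontier_eq]; exact ⟨hqA, h⟩)
      obtain ⟨r, hr, hball⟩ := Metric.isOpen_iff.1 isOpen_interior q hqi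
      filter_upwards [h1 (r / 2) (half_pos hr)] with n hn
      refine iff_of_true ?_ hqA
      by_contra hqn
      -- If `f` separates `q` from `B n`, step from `q` by `r / 2` against the gradient of `f`. The
      -- resulting `y` is still in `A`, but any point within `r / 2` of it has `f`-value below `f
      -- q`, so it is not in `B n`.
      obtain ⟨f, u, hfu, hfB⟩ := geometric_hahn_banach_point_closed (hBc n) (hB n) hqn
      obtain ⟨z, hz⟩ := (InnerProductSpace.toDual ℝ E).surjective f
      have hfz : ∀ v, f v = inner ℝ z v := fun v => by rw [← hz]; simp
      have hf : ∀ b ∈ B n, f q < f b := fun b hb => hfu.trans (hfB b hb)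
      obtain ⟨b₀, hb₀, -⟩ := Metric.mem_thickening_iff.1 (hn hqA)
      have hz0 : z ≠ 0 := by
        rintro rfl
        have := hf b₀ hb₀
        simp [hfz] at this
      have hzn : 0 < ‖z‖ := norm_pos_iff.2 hz0
      let y := q - (r / 2 / ‖z‖) • z
      have hyA : y ∈ A := by
        refine interior_subset (hball ?_)
        rw [Metric.mem_ball, dist_eq_norm]
        have : y - q = -((r / 2 / ‖z‖) • z) := by simp [y]
        rw [this, norm_neg, norm_smul, Real.norm_of_nonneg (by positivity),
          div_mul_cancel₀ _ hzn.ne']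
        linarith
      obtain ⟨b, hb, hyb⟩ := Metric.mem_thickening_iff.1 (hn hyA)
      have e1 : f y = f q - r / 2 * ‖z‖ := by
        have : f z = ‖z‖ * ‖z‖ := by rw [hfz, real_inner_self_eq_norm_mul_norm]
        simp only [y, map_sub, map_smul, this, smul_eq_mul]
        field_simp
      have e2 : f b - f y ≤ ‖z‖ * ‖b - y‖ := by
        rw [← map_sub, hfz]
        exact real_inner_le_norm _ _
      have e3 : ‖b - y‖ < r / 2 := by rwa [← dist_eq_norm, dist_comm]
      have := hf b hb
      nlinarith
    · have : ∃ ε > 0, q ∉ Metric.thickening ε A := by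
        have h3 : q ∉ closure A := by rwa [hA.isClosed.closure_eq]
        rw [Metric.closure_eq_iInter_thickening] at h3
        simpa using h3
      obtain ⟨ε, hε, hqε⟩ := this
      filter_upwards [h2 ε hε] with n hn
      exact iff_of_false (fun h => hqε (hn h)) hqA

theorem convexHull_subset_thickening {E : Type*} [NormedAddCommGroup E] [NormedSpace ℝ E]
    {B B' : Set E} {ε : ℝ} (h : ∀ a ∈ B, ∃ b ∈ B', dist a b < ε) :
    convexHull ℝ B ⊆ Metric.thickening ε (convexHull ℝ B') := by
  refine convexHull_min (fun a ha => ?_) ((convex_convexHull ℝ B').thickening ε)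
  obtain ⟨b, hb, hab⟩ := h a ha
  exact Metric.mem_thickening_iff.2 ⟨b, subset_convexHull ℝ _ hb, hab⟩

theorem volume_convexHull_ofLp {d : ℕ} {ι : Type*} (g : ι → EuclideanSpace ℝ (Fin d))
    (s : Set ι) :
    volume.real (convexHull ℝ (g '' s)) =
      volume.real (convexHull ℝ ((fun i => WithLp.ofLp (g i)) '' s)) := by
  have h1 : convexHull ℝ (g '' s) =
      WithLp.ofLp ⁻¹' (convexHull ℝ ((fun i => WithLp.ofLp (g i)) '' s)) := by
    have h2 : (fun i => WithLp.ofLp (g i)) '' s =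
        (WithLp.linearEquiv 2 ℝ (Fin d → ℝ)).toLinearMap '' (g '' s) := by
      rw [Set.image_image]
      rfl
    rw [h2, ← LinearMap.image_convexHull]
    exact (Set.preimage_image_eq _ (WithLp.linearEquiv 2 ℝ (Fin d → ℝ)).injective).symm
  rw [h1, measureReal_def, measureReal_def]
  congr 1
  exact (PiLp.volume_preserving_ofLp (Fin d)).measure_preimage
    ((convex_convexHull ℝ _).nullMeasurableSet volume)

/-! ### Sampling a path on a mesh -/

theorem div_mem_Icc {i N : ℕ} (h : i ≤ N) : (i : ℝ) / N ∈ Set.Icc (0 : ℝ) 1 :=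
  ⟨by positivity, div_le_one_of_le₀ (by exact_mod_cast h) (by positivity)⟩

theorem IsOrderPath.isOrderSeq {d : ℕ} {y : ℝ → EuclideanSpace ℝ (Fin d)} (hy : IsOrderPath y)
    {N : ℕ} (hN : 0 < N) : IsOrderSeq (fun i : ℕ => WithLp.ofLp (y (i / N))) N := by
  intro i hi hiN
  have hN' : (0 : ℝ) < N := by exact_mod_cast hN
  exact hy.2 (fun k => (i k : ℝ) / N)
    (fun a b hab => div_lt_div_of_pos_right (by exact_mod_cast hi hab) hN')
    fun k => div_mem_Icc (hiN k)

/-- Samples of `x` may be degenerate, so the triangulation is applied to the approximating order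
paths; both sides depend continuously on finitely many points. -/
theorem IsCyclicPath.volume_convexHull_mesh {d : ℕ} {x : ℝ → EuclideanSpace ℝ (Fin d)}
    (hx : IsCyclicPath x) {N : ℕ} (hN : 0 < N) (hdN : d ≤ N) :
    volume.real (convexHull ℝ ((fun i : ℕ => x (i / N)) '' Set.Iic N)) =
      (1 / (d.factorial : ℝ)) * ∑ S ∈ (Finset.range N).powersetCard d,
        (listMatrix (fun i : ℕ => WithLp.ofLp (x ((i + 1 : ℕ) / N)) - WithLp.ofLp (x (i / N)))
          (S.sort (· ≤ ·))).det := by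
  obtain ⟨-, y, hy, hyx⟩ := hx
  have hfin : ∀ g : ℕ → EuclideanSpace ℝ (Fin d), IsCompact (convexHull ℝ (g '' Set.Iic N)) :=
    fun g => ((Set.finite_Iic N).image g).isCompact_convexHull ℝ
  have hunif : ∀ ε > 0, ∀ᶠ n in Filter.atTop, ∀ t ∈ Set.Icc (0 : ℝ) 1, dist (x t) (y n t) < ε :=
    Metric.tendstoUniformlyOn_iff.1 hyx
  have hL : Filter.Tendsto
      (fun n => volume.real (convexHull ℝ ((fun i : ℕ => y n (i / N)) '' Set.Iic N)))
      Filter.atTop (nhds (volume.real (convexHull ℝ ((fun i : ℕ => x (i / N)) '' Set.Iic N)))) := by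
    refine tendsto_volume_of_subset_thickening (hfin _) (convex_convexHull ℝ _)
      (fun n => (hfin _).isClosed) (fun n => convex_convexHull ℝ _) ?_ ?_
    · intro ε hε
      filter_upwards [hunif ε hε] with n hn
      refine convexHull_subset_thickening ?_
      rintro _ ⟨i, hi, rfl⟩
      exact ⟨_, ⟨i, hi, rfl⟩, hn _ (div_mem_Icc hi)⟩
    · intro ε hε
      filter_upwards [hunif ε hε] with n hn
      refine convexHull_subset_thickening ?_
      rintro _ ⟨i, hi, rfl⟩
      exact ⟨_, ⟨i, hi, rfl⟩, by rw [dist_comm]; exact hn _ (div_mem_Icc hi)⟩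
  refine tendsto_nhds_unique hL ?_
  have heq : ∀ n, volume.real (convexHull ℝ ((fun i : ℕ => y n (i / N)) '' Set.Iic N)) = _ :=
    fun n => (volume_convexHull_ofLp _ _).trans (((hy n).isOrderSeq hN).volume_convexHull hdN)
  simp only [heq]
  refine Filter.Tendsto.const_mul _ (tendsto_finsetSum _ fun S hS => ?_)
  have hpt : ∀ i ≤ N, Filter.Tendsto (fun n => y n ((i : ℕ) / N)) Filter.atTop
      (nhds (x (i / N))) := fun i hi => hyx.tendsto_at (div_mem_Icc hi)
  have hS' := Finset.mem_powersetCard.1 hS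
  refine (Continuous.matrix_det continuous_id).continuousAt.tendsto.comp ?_
  refine tendsto_pi_nhds.2 fun a => tendsto_pi_nhds.2 fun b => ?_
  have hb : (S.sort (· ≤ ·)).getD b 0 < N := by
    have := getD_mem_of_length (l := S.sort (· ≤ ·)) (by rw [Finset.length_sort, hS'.2]) b
    exact Finset.mem_range.1 (hS'.1 ((Finset.mem_sort _).1 this))
  have hcoord : ∀ i ≤ N, Filter.Tendsto (fun n => y n ((i : ℕ) / N) a) Filter.atTop
      (nhds (x (i / N) a)) := fun i hi =>
    ((EuclideanSpace.proj (𝕜 := ℝ) a).continuous.tendsto _).comp (hpt i hi)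
  exact (hcoord _ hb).sub (hcoord _ hb.le)

theorem IsLipschitzPath.tendsto_volume_mesh {d : ℕ} {x : ℝ → EuclideanSpace ℝ (Fin d)}
    (hx : IsLipschitzPath x) :
    Filter.Tendsto
      (fun N : ℕ => volume.real (convexHull ℝ ((fun i : ℕ => x (i / N)) '' Set.Iic N)))
      Filter.atTop (nhds (volume.real (convexHull ℝ (x '' Set.Icc (0 : ℝ) 1)))) := by
  obtain ⟨K, hK⟩ := hx
  have hbdd : Bornology.IsBounded (convexHull ℝ (x '' Set.Icc (0 : ℝ) 1)) :=
    isBounded_convexHull.2 (isCompact_Icc.image_of_continuousOn hK.continuousOn).isBounded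
  have hvol : volume.real (convexHull ℝ (x '' Set.Icc (0 : ℝ) 1)) =
      volume.real (closure (convexHull ℝ (x '' Set.Icc (0 : ℝ) 1))) := by
    rw [measureReal_def, measureReal_def, measure_closure_of_null_frontier
      ((convex_convexHull ℝ _).addHaar_frontier volume)]
  rw [hvol]
  refine tendsto_volume_of_subset_thickening hbdd.isCompact_closure (convex_convexHull ℝ _).closure
    (fun N => ((Set.finite_Iic N).image _).isCompact_convexHull ℝ |>.isClosed)
    (fun N => convex_convexHull ℝ _) ?_ ?_
  · intro ε hε
    have hlim : Filter.Tendsto (fun N : ℕ => (K : ℝ) / N) Filter.atTop (nhds 0) :=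
      tendsto_const_div_atTop_nhds_zero_nat _
    filter_upwards [hlim.eventually (gt_mem_nhds (half_pos hε)), Filter.eventually_gt_atTop 0]
      with N hN hN0
    refine (closure_mono (convexHull_subset_thickening (ε := ε / 2) ?_)).trans
      ((Metric.closure_thickening_subset_cthickening _ _).trans
        (Metric.cthickening_subset_thickening' hε (half_lt_self hε) _))
    rintro _ ⟨t, ht, rfl⟩
    have hN' : (0 : ℝ) < N := by exact_mod_cast hN0
    have htN : 0 ≤ t * N := mul_nonneg ht.1 hN'.le
    have hle : ⌊t * N⌋₊ ≤ N := Nat.floor_le_of_le (by nlinarith [ht.2])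
    -- The mesh point just below `t` is at distance at most `1 / N`, hence at most `K / N` along the
    -- path.
    refine ⟨_, ⟨⌊t * N⌋₊, hle, rfl⟩, lt_of_le_of_lt (hK.dist_le_mul _ ht _ (div_mem_Icc hle)) ?_⟩
    refine lt_of_le_of_lt ?_ hN
    rw [div_eq_mul_inv (K : ℝ)]
    refine mul_le_mul_of_nonneg_left ?_ K.2
    have h1 := Nat.floor_le htN
    have h2 := (Nat.lt_floor_add_one (t * N)).le
    rw [Real.dist_eq, abs_le]
    have h3 : t - ⌊t * N⌋₊ / N = (t * N - ⌊t * N⌋₊) * (N : ℝ)⁻¹ := by field_simp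
    have h4 := inv_pos.2 hN'
    rw [h3]
    constructor <;> nlinarith
  · intro ε hε
    filter_upwards with N
    rw [Metric.thickening_closure]
    refine convexHull_subset_thickening ?_
    rintro _ ⟨i, hi, rfl⟩
    exact ⟨_, ⟨_, div_mem_Icc hi, rfl⟩, by simpa using hε⟩

/-! ### Derivatives of Lipschitz paths -/

theorem LipschitzOnWith.euclidean_coordinate {d : ℕ} {x : ℝ → EuclideanSpace ℝ (Fin d)} {K : NNReal}
    {s : Set ℝ} (hK : LipschitzOnWith K x s) (a : Fin d) :
    LipschitzOnWith K (fun t => x t a) s := by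
  refine LipschitzOnWith.of_dist_le_mul fun u hu v hv => le_trans ?_ (hK.dist_le_mul u hu v hv)
  rw [dist_eq_norm, dist_eq_norm, ← PiLp.sub_apply]
  exact PiLp.norm_apply_le _ _

theorem pathDeriv_ae_eq {d : ℕ} {x : ℝ → EuclideanSpace ℝ (Fin d)} (hx : IsLipschitzPath x)
    (a : Fin d) :
    ∀ᵐ t ∂(volume.restrict (Set.Icc (0 : ℝ) 1)), deriv (fun t => x t a) t = pathDeriv x t a := by
  obtain ⟨K, hK⟩ := hx
  -- Dropping the two end points makes the derivative within `[0,1]` an ordinary derivative.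
  rw [← restrict_Ioo_eq_restrict_Icc]
  refine (ae_restrict_iff' measurableSet_Ioo).2 ?_
  filter_upwards [hK.ae_differentiableWithinAt_of_mem_real] with t ht hmem
  have hnhds : Set.Icc (0 : ℝ) 1 ∈ nhds t := Icc_mem_nhds hmem.1 hmem.2
  have hd : DifferentiableAt ℝ x t :=
    (ht (Set.Ioo_subset_Icc_self hmem)).differentiableAt hnhds
  rw [pathDeriv, derivWithin_of_mem_nhds hnhds]
  exact ((EuclideanSpace.proj (𝕜 := ℝ) a).hasFDerivAt.comp_hasDerivAt t hd.hasDerivAt).deriv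

theorem integrableOn_pathDeriv {d : ℕ} {x : ℝ → EuclideanSpace ℝ (Fin d)}
    (hx : IsLipschitzPath x) (a : Fin d) :
    IntegrableOn (fun t => pathDeriv x t a) (Set.Icc (0 : ℝ) 1) := by
  have hae := pathDeriv_ae_eq hx a
  obtain ⟨K, hK⟩ := hx
  have hac : AbsolutelyContinuousOnInterval (fun t => x t a) 0 1 := by
    refine LipschitzOnWith.absolutelyContinuousOnInterval (K := K) ?_
    rw [Set.uIcc_of_le zero_le_one]
    exact hK.euclidean_coordinate a
  have h1 := (intervalIntegrable_iff_integrableOn_Icc_of_le zero_le_one).1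
    hac.intervalIntegrable_deriv
  exact h1.congr_fun_ae hae

theorem setIntegral_pathDeriv {d : ℕ} {x : ℝ → EuclideanSpace ℝ (Fin d)}
    (hx : IsLipschitzPath x) (a : Fin d) {r s : ℝ} (hr : 0 ≤ r) (hrs : r ≤ s) (hs : s ≤ 1) :
    ∫ t in Set.Ico r s, pathDeriv x t a = x s a - x r a := by
  have hsub : Set.Ico r s ⊆ Set.Icc (0 : ℝ) 1 :=
    Set.Ico_subset_Icc_self.trans (Set.Icc_subset_Icc hr hs)
  have hae := ae_restrict_of_ae_restrict_of_subset hsub (pathDeriv_ae_eq hx a)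
  obtain ⟨K, hK⟩ := hx
  have hac : AbsolutelyContinuousOnInterval (fun t => x t a) r s := by
    refine LipschitzOnWith.absolutelyContinuousOnInterval (K := K) ?_
    rw [Set.uIcc_of_le hrs]
    exact (hK.euclidean_coordinate a).mono (Set.Icc_subset_Icc hr hs)
  rw [← integral_congr_ae hae, integral_Ico_eq_integral_Ioo, ← integral_Ioc_eq_integral_Ioo,
    ← intervalIntegral.integral_of_le hrs, hac.integral_deriv_eq_sub]

/-! ### Exhausting the ordered simplex by mesh boxes -/

/-- Fubini's theorem for the determinant of a matrix whose columns depend on separate variables. -/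
theorem integral_det_pi {d : ℕ} {f : Fin d → ℝ → ℝ} {I : Fin d → Set ℝ}
    (hf : ∀ a j, IntegrableOn (f a) (I j)) :
    IntegrableOn (fun t : Fin d → ℝ => (Matrix.of fun i j => f i (t j)).det) (Set.univ.pi I) ∧
      ∫ t in Set.univ.pi I, (Matrix.of fun i j => f i (t j)).det =
        (Matrix.of fun i j => ∫ s in I j, f i s).det := by
  have hint : ∀ σ : Equiv.Perm (Fin d), Integrable (fun t : Fin d → ℝ => ∏ j, f (σ j) (t j))
      (Measure.pi fun j => volume.restrict (I j)) :=
    fun σ => Integrable.fintype_prod (f := fun j => f (σ j)) fun j => hf (σ j) j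
  rw [IntegrableOn, volume_pi, Measure.restrict_pi_pi]
  simp only [Matrix.det_apply', Matrix.of_apply]
  refine ⟨integrable_finsetSum _ fun σ _ => (hint σ).const_mul _, ?_⟩
  rw [integral_finsetSum _ fun σ _ => (hint σ).const_mul _]
  refine Finset.sum_congr rfl fun σ _ => ?_
  rw [integral_const_mul, integral_fintype_prod_eq_prod (fun j => f (σ j))]

theorem measurableSet_orderedSimplex (d : ℕ) : MeasurableSet (orderedSimplex d) := by
  have h : orderedSimplex d = (⋂ i, ⋂ j, ⋂ _ : i < j, {t : Fin d → ℝ | t i < t j}) ∩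
      Set.univ.pi fun _ => Set.Icc (0 : ℝ) 1 := by
    ext t
    simp only [orderedSimplex, StrictMono, Set.mem_ofPred_eq, Set.mem_inter_iff, Set.mem_iInter,
      Set.mem_univ_pi]
  rw [h]
  refine MeasurableSet.inter ?_ (MeasurableSet.univ_pi fun _ => measurableSet_Icc)
  exact MeasurableSet.iInter fun i => MeasurableSet.iInter fun j => MeasurableSet.iInter fun _ =>
    measurableSet_lt (measurable_pi_apply i) (measurable_pi_apply j)

/-- The box of the mesh of width `1 / N` given by the elements of `S` in increasing order. -/
def meshBox (d N : ℕ) (S : Finset ℕ) : Set (Fin d → ℝ) :=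
  Set.univ.pi fun j => Set.Ico (((S.sort (· ≤ ·)).getD j 0 : ℕ) / (N : ℝ))
    ((((S.sort (· ≤ ·)).getD j 0 + 1 : ℕ) : ℝ) / (N : ℝ))

theorem sort_getD_eq_orderEmbOfFin {d : ℕ} {S : Finset ℕ} (hS : S.card = d) (j : Fin d) :
    (S.sort (· ≤ ·)).getD j 0 = S.orderEmbOfFin hS j := by
  rw [Finset.orderEmbOfFin_apply, List.getD_eq_getElem _ _ (by simp [hS])]
  rfl

/-- With half-open cells a point determines its box through floors, which gives disjointness of the
boxes and their inclusion in the simplex. -/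
theorem mem_meshBox_iff {d N : ℕ} (hN : 0 < N) {S : Finset ℕ} (hS : S.card = d)
    {t : Fin d → ℝ} : t ∈ meshBox d N S ↔
      (∀ j, 0 ≤ t j) ∧ ∀ j, ⌊t j * N⌋₊ = S.orderEmbOfFin hS j := by
  have hN' : (0 : ℝ) < N := by exact_mod_cast hN
  rw [meshBox, Set.mem_univ_pi, ← forall_and]
  refine forall_congr' fun j => ?_
  rw [sort_getD_eq_orderEmbOfFin hS, Set.mem_Ico, div_le_iff₀ hN', lt_div_iff₀ hN']
  constructor
  · rintro ⟨h1, h2⟩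
    have h0 : 0 ≤ t j := by
      by_contra h
      have : t j * N < 0 := mul_neg_of_neg_of_pos (not_le.1 h) hN'
      have : (0 : ℝ) ≤ (S.orderEmbOfFin hS j : ℕ) := Nat.cast_nonneg _
      linarith
    refine ⟨h0, (Nat.floor_eq_iff (mul_nonneg h0 hN'.le)).2 ⟨h1, ?_⟩⟩
    push_cast at h2
    exact h2
  · rintro ⟨h0, h1⟩
    have := (Nat.floor_eq_iff (mul_nonneg h0 hN'.le)).1 h1
    push_cast
    exact this

theorem meshBox_subset_orderedSimplex {d N : ℕ} (hN : 0 < N) {S : Finset ℕ}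
    (hS : S ∈ (Finset.range N).powersetCard d) : meshBox d N S ⊆ orderedSimplex d := by
  obtain ⟨hS1, hS2⟩ := Finset.mem_powersetCard.1 hS
  have hN' : (0 : ℝ) < N := by exact_mod_cast hN
  intro t ht
  obtain ⟨h0, h1⟩ := (mem_meshBox_iff hN hS2).1 ht
  refine ⟨fun i j hij => ?_, fun j => ⟨h0 j, ?_⟩⟩
  · have h2 : ⌊t i * N⌋₊ < ⌊t j * N⌋₊ := by
      rw [h1, h1]
      exact (S.orderEmbOfFin hS2).strictMono hij
    by_contra h
    exact absurd (Nat.floor_mono (mul_le_mul_of_nonneg_right (not_lt.1 h) hN'.le)) (not_le.2 h2)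
  · have h2 : ⌊t j * N⌋₊ < N := by
      rw [h1]
      exact Finset.mem_range.1 (hS1 (S.orderEmbOfFin_mem hS2 j))
    have h3 := (Nat.floor_lt (mul_nonneg (h0 j) hN'.le)).1 h2
    by_contra h
    nlinarith [not_le.1 h]

theorem disjoint_meshBox {d N : ℕ} (hN : 0 < N) {S S' : Finset ℕ} (hS : S.card = d)
    (hS' : S'.card = d) (hne : S ≠ S') : Disjoint (meshBox d N S) (meshBox d N S') := by
  rw [Set.disjoint_left]
  intro t ht ht'
  have h1 := ((mem_meshBox_iff hN hS).1 ht).2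
  have h2 := ((mem_meshBox_iff hN hS').1 ht').2
  refine hne ?_
  rw [← Finset.coe_inj, ← S.range_orderEmbOfFin hS, ← S'.range_orderEmbOfFin hS']
  congr 1
  funext j
  rw [← h1, h2]

/-- Once `N` times every gap between coordinates exceeds `1`, the coordinates fall into distinct
cells. Half-open cells miss the value `1`, hence `h1`. -/
theorem eventually_mem_meshBox {d : ℕ} {t : Fin d → ℝ} (ht : t ∈ orderedSimplex d)
    (h1 : ∀ j, t j ≠ 1) :
    ∀ᶠ N : ℕ in Filter.atTop, t ∈ ⋃ S ∈ (Finset.range N).powersetCard d, meshBox d N S := by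
  have hsep : ∀ i j : Fin d, i < j → ∀ᶠ N : ℕ in Filter.atTop, 1 < (t j - t i) * N := by
    intro i j hij
    have hpos : 0 < t j - t i := sub_pos.2 (ht.1 hij)
    exact (tendsto_natCast_atTop_atTop.const_mul_atTop hpos).eventually_gt_atTop 1
  have hall : ∀ᶠ N : ℕ in Filter.atTop, ∀ i j : Fin d, i < j → 1 < (t j - t i) * N := by
    simp only [Filter.eventually_all]
    exact hsep
  filter_upwards [hall, Filter.eventually_gt_atTop 0] with N hN hN0
  have hN' : (0 : ℝ) < N := by exact_mod_cast hN0
  let k : Fin d → ℕ := fun j => ⌊t j * N⌋₊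
  have hk : StrictMono k := by
    intro i j hij
    have h2 := hN i j hij
    have h3 : t i * N + 1 ≤ t j * N := by linarith
    have h4 : 0 ≤ t i * N := mul_nonneg (ht.2 i).1 hN'.le
    have := Nat.floor_mono h3
    rw [Nat.floor_add_one h4] at this
    exact this
  have hcard : (Finset.univ.image k).card = d := by
    rw [Finset.card_image_of_injective _ hk.injective, Finset.card_univ, Fintype.card_fin]
  refine Set.mem_biUnion (x := Finset.univ.image k) ?_ ((mem_meshBox_iff hN0 hcard).2
    ⟨fun j => (ht.2 j).1, fun j => ?_⟩)
  · refine Finset.mem_coe.2 (Finset.mem_powersetCard.2 ⟨?_, hcard⟩)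
    intro n hn
    obtain ⟨j, -, rfl⟩ := Finset.mem_image.1 hn
    rw [Finset.mem_range]
    refine (Nat.floor_lt (mul_nonneg (ht.2 j).1 hN'.le)).2 ?_
    have : t j < 1 := lt_of_le_of_ne (ht.2 j).2 (h1 j)
    nlinarith
  · exact congrFun (Finset.orderEmbOfFin_unique hcard
      (fun j => Finset.mem_image_of_mem k (Finset.mem_univ j)) hk) j

theorem integrableOn_det_pathDeriv {d : ℕ} {x : ℝ → EuclideanSpace ℝ (Fin d)}
    (hx : IsLipschitzPath x) :
    IntegrableOn (fun t : Fin d → ℝ => (Matrix.of fun i j : Fin d => pathDeriv x (t j) i).det)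
      (orderedSimplex d) :=
  (integral_det_pi (f := fun a s => pathDeriv x s a) (I := fun _ => Set.Icc (0 : ℝ) 1)
    fun a _ => integrableOn_pathDeriv hx a).1.mono_set fun _ ht j _ => ht.2 j

theorem integral_meshBox {d N : ℕ} (hN : 0 < N) {x : ℝ → EuclideanSpace ℝ (Fin d)}
    (hx : IsLipschitzPath x) {S : Finset ℕ} (hS : S ∈ (Finset.range N).powersetCard d) :
    ∫ t in meshBox d N S, (Matrix.of fun i j : Fin d => pathDeriv x (t j) i).det =
      (listMatrix (fun i : ℕ => WithLp.ofLp (x ((i + 1 : ℕ) / N)) - WithLp.ofLp (x (i / N)))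
        (S.sort (· ≤ ·))).det := by
  obtain ⟨hS1, hS2⟩ := Finset.mem_powersetCard.1 hS
  have hlt : ∀ j : Fin d, (S.sort (· ≤ ·)).getD j 0 + 1 ≤ N := fun j => by
    rw [sort_getD_eq_orderEmbOfFin hS2]
    exact Finset.mem_range.1 (hS1 (S.orderEmbOfFin_mem hS2 j))
  have h0 : ∀ j : Fin d, 0 ≤ (((S.sort (· ≤ ·)).getD j 0 : ℕ) / (N : ℝ)) := fun j => by positivity
  have h1 : ∀ j : Fin d, ((((S.sort (· ≤ ·)).getD j 0 + 1 : ℕ) : ℝ) / (N : ℝ)) ≤ 1 :=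
    fun j => (div_mem_Icc (hlt j)).2
  rw [meshBox, (integral_det_pi (f := fun a s => pathDeriv x s a) fun a j =>
    (integrableOn_pathDeriv hx a).mono_set
      (Set.Ico_subset_Icc_self.trans (Set.Icc_subset_Icc (h0 j) (h1 j)))).2]
  congr 1
  ext a j
  rw [Matrix.of_apply, setIntegral_pathDeriv hx a (h0 j) (by gcongr; omega) (h1 j)]
  rfl

/-- Each summand is the integral over one box, so the sum is the integral over the union of the
boxes; dominated convergence finishes, with the integrand itself as bound. -/
theorem tendsto_sum_det_increments {d : ℕ} {x : ℝ → EuclideanSpace ℝ (Fin d)}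
    (hx : IsLipschitzPath x) :
    Filter.Tendsto (fun N : ℕ => ∑ S ∈ (Finset.range N).powersetCard d,
        (listMatrix (fun i : ℕ => WithLp.ofLp (x ((i + 1 : ℕ) / N)) - WithLp.ofLp (x (i / N)))
          (S.sort (· ≤ ·))).det) Filter.atTop
      (nhds (∫ t in orderedSimplex d,
        (Matrix.of fun i j : Fin d => pathDeriv x (t j) i).det)) := by
  set g : (Fin d → ℝ) → ℝ := fun t => (Matrix.of fun i j : Fin d => pathDeriv x (t j) i).det
    with hg
  have hint : IntegrableOn g (orderedSimplex d) := integrableOn_det_pathDeriv hx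
  have hΔ := measurableSet_orderedSimplex d
  have hbox : ∀ N S, MeasurableSet (meshBox d N S) := fun N S =>
    MeasurableSet.univ_pi fun _ => measurableSet_Ico
  let U : ℕ → Set (Fin d → ℝ) := fun N => ⋃ S ∈ (Finset.range N).powersetCard d, meshBox d N S
  have hU : ∀ N, MeasurableSet (U N) := fun N =>
    Finset.measurableSet_biUnion _ fun S _ => hbox N S
  have hUΔ : ∀ N, 0 < N → U N ⊆ orderedSimplex d := fun N hN =>
    Set.iUnion₂_subset fun S hS => meshBox_subset_orderedSimplex hN hS
  have hlim : Filter.Tendsto (fun N => ∫ t in orderedSimplex d, (U N).indicator g t) Filter.atTop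
      (nhds (∫ t in orderedSimplex d, g t)) := by
    refine tendsto_integral_of_dominated_convergence (fun t => ‖g t‖)
      (fun N => hint.aestronglyMeasurable.indicator (hU N)) hint.norm
      (fun N => Filter.Eventually.of_forall fun t => norm_indicator_le_norm_self _ _) ?_
    have hne : ∀ᵐ t : Fin d → ℝ, ∀ j, t j ≠ 1 := by
      rw [ae_all_iff]
      intro j
      rw [volume_pi]
      exact measure_eq_zero_iff_ae_notMem.1 (Measure.pi_hyperplane _ j 1)
    filter_upwards [ae_restrict_mem hΔ, ae_restrict_of_ae hne] with t ht h1
    refine tendsto_const_nhds.congr' ?_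
    filter_upwards [eventually_mem_meshBox ht h1] with N hN
    exact (Set.indicator_of_mem hN g).symm
  refine hlim.congr' ?_
  filter_upwards [Filter.eventually_gt_atTop 0] with N hN
  rw [setIntegral_indicator (hU N), Set.inter_eq_self_of_subset_right (hUΔ N hN),
    integral_biUnion_finset _ (fun S _ => hbox N S)
      (fun S hS S' hS' hne => disjoint_meshBox hN (Finset.mem_powersetCard.1 hS).2
        (Finset.mem_powersetCard.1 hS').2 hne)
      (fun S hS => hint.mono_set (meshBox_subset_orderedSimplex hN hS))]
  exact Finset.sum_congr rfl fun S hS => integral_meshBox hN hx hS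

theorem theorem3p5 {d : ℕ} (x : ℝ → EuclideanSpace ℝ (Fin d)) (hx : IsCyclicPath x) :
    MeasureTheory.IntegrableOn
        (fun t : Fin d → ℝ => (Matrix.of fun i j : Fin d => pathDeriv x (t j) i).det)
        (orderedSimplex d) ∧
      MeasureTheory.volume.real (convexHull ℝ (x '' Set.Icc (0 : ℝ) 1)) =
        topAlternatingSignature x ∧
      topAlternatingSignature x =
        (1 / (d.factorial : ℝ)) *
          ∫ t in orderedSimplex d,
            (Matrix.of fun i j : Fin d => pathDeriv x (t j) i).det := by
  have hsig : topAlternatingSignature x = (1 / (d.factorial : ℝ)) *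
      ∫ t in orderedSimplex d, (Matrix.of fun i j : Fin d => pathDeriv x (t j) i).det := rfl
  refine ⟨integrableOn_det_pathDeriv hx.1, ?_, hsig⟩
  rw [hsig]
  -- For `N ≥ d + 1` the hull volume of the sample equals the scaled sum of determinants, so the two
  -- limits coincide.
  refine tendsto_nhds_unique hx.1.tendsto_volume_mesh
    (((tendsto_sum_det_increments hx.1).const_mul (1 / (d.factorial : ℝ))).congr' ?_)
  filter_upwards [Filter.eventually_ge_atTop (d + 1)] with N hN
  exact (hx.volume_convexHull_mesh (by omega) (by omega)).symm
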